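/- Let $m$ be a positive integer. Write $(b)_k=b(b+1)\cdots(b+k-1)$, and for $c>0$ let $$\Phi_2^{(4)}(b_1,b_2,b_3,b_4;c;x_1,x_2,x_3,x_4)=\sum_{k_1,k_2,k_3,k_4\ge 0}\frac{(b_1)_{k_1}(b_2)_{k_2}(b_3)_{k_3}(b_4)_{k_4}}{(c)_{k_1+k_2+k_3+k_4}}\,\frac{x_1^{k_1}}{k_1!}\frac{x_2^{k_2}}{k_2!}\frac{x_3^{k_3}}{k_3!}\frac{x_4^{k_4}}{k_4!}$$ (an absolutely convergent series) be the confluent hypergeometric function in four variables. Put $C_q^n=\binom nq\binom{2n-2q}{n}$. For $\mu>0$, $K\ge 0$, $\Delta\in[0,1]$, $\overline\gamma>0$ let $$S=\sqrt{(m+\mu K)^2-\mu^2K^2\Delta^2},\qquad a_1=\frac{(1+K)m\mu}{(m+\mu K)\overline\gamma},\quad a_2=\frac{(1+K)m\mu}{(m+\mu K(1+\Delta))\overline\gamma},\quad a_3=\frac{(1+K)m\mu}{(m+\mu K(1-\Delta))\overline\gamma},\quad a_4=\frac{(1+K)\mu}{\overline\gamma}.$$ **The MFTR (multicluster fluctuating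 two-ray) SNR.** (i) *Physical model, $\mu$ a positive integer.* Let $V_1,V_2,U_2,\dots,U_\mu\ge 0$, $\sigma>0$, $E_s>0$, $N_0>0$ be constants, let $\zeta$ be Gamma distributed with shape $m$ and mean $1$, let $\phi_1,\phi_2,\varphi_2,\dots,\varphi_\mu$ be uniform on $(0,2\pi)$, let $X_1,Y_1,\dots,X_\mu,Y_\mu$ be Gaussian with mean $0$ and variance $\sigma^2$, and let all these random variables be independent. With $Z_i=X_i+\mathrm{j}Y_i$, the SNR is $$\gamma=\frac{E_s}{N_0}\Bigl(\bigl|\sqrt\zeta\,(V_1e^{\mathrm{j}\phi_1}+V_2e^{\mathrm{j}\phi_2})+Z_1\bigr|^2+\sum_{i=2}^{\mu}\bigl|\sqrt\zeta\,U_ie^{\mathrm{j}\varphi_i}+Z_i\bigr|^2\Bigr),$$ and one puts $$\overline\gamma=\mathbb E[\gamma],\qquad K=\frac{V_1^2+V_2^2+\sum_{i=2}^\mu U_i^2}{2\sigma^2\mu},\qquad \Delta=\frac{2V_1V_2}{V_1^2+V_2^2+\sum_{i=2}^\mu U_i^2}$$ ($\Delta=0$ if $V_1=V_2=U_2=\dots=U_\mu=0$).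 (ii) *Generalized model, $\mu>0$ real, with parameters $K\ge 0$, $\Delta\in[0,1]$, $\overline\gamma>0$.* Here $\theta$ is uniform on $(0,2\pi)$, and given $\theta$ the SNR $\gamma$ is $\kappa$-$\mu$ shadowed with parameters $\kappa_\theta=K(1+\Delta\cos\theta)$, $\mu$, $m$ and mean $\overline\gamma_\theta=\overline\gamma\,(1+\kappa_\theta)/(1+K)$. The $\kappa$-$\mu$ shadowed law with parameters $\kappa,\mu,m$ and mean $\overline\gamma'$ is the law of $\gamma$ when $\zeta$ is Gamma distributed with shape $m$ and mean $1$, given $\zeta$ the variable $N$ is Poisson with mean $\zeta\mu\kappa$, and given $\zeta$ and $N$ the variable $\gamma$ is Gamma distributed with shape $\mu+N$ and rate $\mu(1+\kappa)/\overline\gamma'$ (that is, given $\zeta$, $\gamma$ is, up to scale, noncentral chi-square with $2\mu$ degrees of freedom). **Statement.** In both cases (i) and (ii), $\gamma$ is concentrated on $(0,\infty)$ and has there the (nonnegative) probability density $$f_\gamma(x)=\frac{(1+K)^\mu\mu^\mu}{2^{m-1}\Gamma(\mu)\overline\gamma^\mu}\Bigl(\frac mS\Bigr)^m\sum_{q=0}^{\lfloor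 (m-1)/2\rfloor}(-1)^qC_q^{m-1}\Bigl(\frac{m+\mu K}{S}\Bigr)^{m-1-2q}x^{\mu-1}\,\Phi_2^{(4)}\bigl(1+2q-m,\,m-q-\tfrac12,\,m-q-\tfrac12,\,\mu-m;\,\mu;\,-a_1x,-a_2x,-a_3x,-a_4x\bigr),\quad x>0,$$ and its distribution function is $$F_\gamma(x)=\frac{(1+K)^\mu\mu^\mu}{2^{m-1}\Gamma(\mu+1)\overline\gamma^\mu}\Bigl(\frac mS\Bigr)^m\sum_{q=0}^{\lfloor (m-1)/2\rfloor}(-1)^qC_q^{m-1}\Bigl(\frac{m+\mu K}{S}\Bigr)^{m-1-2q}x^{\mu}\,\Phi_2^{(4)}\bigl(1+2q-m,\,m-q-\tfrac12,\,m-q-\tfrac12,\,\mu-m;\,\mu+1;\,-a_1x,-a_2x,-a_3x,-a_4x\bigr),\quad x\ge 0.$$ -/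

import Mathlib

open MeasureTheory ProbabilityTheory

/-- General term of the confluent hypergeometric series in four variables:
`(b₁)_{k₁} (b₂)_{k₂} (b₃)_{k₃} (b₄)_{k₄} / (c)_{k₁+k₂+k₃+k₄}
  * x₁^{k₁}/k₁! * x₂^{k₂}/k₂! * x₃^{k₃}/k₃! * x₄^{k₄}/k₄!`,
where `(b)_k = b (b+1) ⋯ (b+k-1)`. -/
noncomputable def phi2Term (b₁ b₂ b₃ b₄ c x₁ x₂ x₃ x₄ : ℝ) (k : ℕ × ℕ × ℕ × ℕ) : ℝ :=
  ((ascPochhammer ℝ k.1).eval b₁ * (ascPochhammer ℝ k.2.1).eval b₂ *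
      (ascPochhammer ℝ k.2.2.1).eval b₃ * (ascPochhammer ℝ k.2.2.2).eval b₄) /
    (ascPochhammer ℝ (k.1 + k.2.1 + k.2.2.1 + k.2.2.2)).eval c *
    ((x₁ ^ k.1 / (k.1.factorial : ℝ)) * (x₂ ^ k.2.1 / (k.2.1.factorial : ℝ)) *
      (x₃ ^ k.2.2.1 / (k.2.2.1.factorial : ℝ)) * (x₄ ^ k.2.2.2 / (k.2.2.2.factorial : ℝ)))

/-- The confluent hypergeometric function `Φ₂⁽⁴⁾(b₁, b₂, b₃, b₄; c; x₁, x₂, x₃, x₄)`. For `c > 0`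
the series converges absolutely, see `summable_phi2Term`. -/
noncomputable def phi2Four (b₁ b₂ b₃ b₄ c x₁ x₂ x₃ x₄ : ℝ) : ℝ :=
  ∑' k : ℕ × ℕ × ℕ × ℕ, phi2Term b₁ b₂ b₃ b₄ c x₁ x₂ x₃ x₄ k

theorem abs_ascPochhammer_eval_le (b : ℝ) (k : ℕ) :
    |(ascPochhammer ℝ k).eval b| ≤ (|b| + 1) ^ k * (k.factorial : ℝ) := by
  induction k with
  | zero => simp
  | succ k ih =>
    rw [ascPochhammer_succ_eval, abs_mul, Nat.factorial_succ, pow_succ]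
    have h : |b + (k : ℝ)| ≤ (|b| + 1) * ((k : ℝ) + 1) := by
      have h1 : |b + (k : ℝ)| ≤ |b| + k := by
        simpa using abs_add_le b (k : ℝ)
      nlinarith [abs_nonneg b, mul_nonneg (abs_nonneg b) (Nat.cast_nonneg (α := ℝ) k)]
    calc _ ≤ ((|b| + 1) ^ k * (k.factorial : ℝ)) * ((|b| + 1) * ((k : ℝ) + 1)) :=
          mul_le_mul ih h (abs_nonneg _) (by positivity)
      _ = _ := by push_cast; ring

theorem le_ascPochhammer_eval (c : ℝ) (hc : 0 < c) (k : ℕ) :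
    (min c 1) ^ k * (k.factorial : ℝ) ≤ (ascPochhammer ℝ k).eval c := by
  have he : 0 < min c 1 := lt_min hc one_pos
  induction k with
  | zero => simp
  | succ k ih =>
    rw [ascPochhammer_succ_eval, Nat.factorial_succ, pow_succ]
    have h : min c 1 * ((k : ℝ) + 1) ≤ c + k := by
      have hk : (0 : ℝ) ≤ k := Nat.cast_nonneg k
      nlinarith [min_le_left c 1, min_le_right c 1]
    calc _ = ((min c 1) ^ k * (k.factorial : ℝ)) * (min c 1 * ((k : ℝ) + 1)) := by
          push_cast; ring
      _ ≤ _ := mul_le_mul ih h (by positivity) (ascPochhammer_pos k c hc).le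

theorem summable_phi2Term (b₁ b₂ b₃ b₄ c x₁ x₂ x₃ x₄ : ℝ) (hc : 0 < c) :
    Summable (phi2Term b₁ b₂ b₃ b₄ c x₁ x₂ x₃ x₄) := by
  have he : 0 < min c 1 := lt_min hc one_pos
  set e := min c 1 with hedef
  let g : ℝ → ℝ → ℕ → ℝ := fun b x k => ((|b| + 1) * |x| / e) ^ k / (k.factorial : ℝ)
  have hg : ∀ b x, Summable (g b x) := fun b x => Real.summable_pow_div_factorial _
  have hg0 : ∀ b x, 0 ≤ g b x := fun b x k => by
    simp only [g, Pi.zero_apply]; positivity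
  have h34 := (hg b₃ x₃).mul_of_nonneg (hg b₄ x₄) (hg0 _ _) (hg0 _ _)
  have h234 := (hg b₂ x₂).mul_of_nonneg h34 (hg0 _ _)
    (fun k => mul_nonneg (hg0 _ _ _) (hg0 _ _ _))
  have h := (hg b₁ x₁).mul_of_nonneg h234 (hg0 _ _)
    (fun k => mul_nonneg (hg0 _ _ _) (mul_nonneg (hg0 _ _ _) (hg0 _ _ _)))
  refine Summable.of_norm_bounded h ?_
  rintro ⟨i, j, k, l⟩
  have hN := le_ascPochhammer_eval c hc (i + j + k + l)
  have hpos := ascPochhammer_pos (i + j + k + l) c hc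
  have hfac : ((i.factorial : ℝ) * j.factorial * k.factorial * l.factorial) ≤
      ((i + j + k + l).factorial : ℝ) := by
    have h1 := Nat.factorial_mul_factorial_dvd_factorial_add i j
    have h2 := Nat.factorial_mul_factorial_dvd_factorial_add (i + j) k
    have h3 := Nat.factorial_mul_factorial_dvd_factorial_add (i + j + k) l
    have h4 : i.factorial * j.factorial * k.factorial * l.factorial ∣ (i + j + k + l).factorial :=
      ((mul_dvd_mul_right ((mul_dvd_mul_right h1 _).trans h2) _).trans h3)
    exact_mod_cast Nat.le_of_dvd (Nat.factorial_pos _) h4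
  have hN' : e ^ (i + j + k + l) *
      ((i.factorial : ℝ) * j.factorial * k.factorial * l.factorial) ≤
      (ascPochhammer ℝ (i + j + k + l)).eval c :=
    (mul_le_mul_of_nonneg_left hfac (by positivity)).trans hN
  simp only [phi2Term, Real.norm_eq_abs, abs_mul, abs_div, abs_pow, Nat.abs_cast,
    abs_of_pos hpos]
  have hb := fun (b : ℝ) (n : ℕ) => abs_ascPochhammer_eval_le b n
  calc _ ≤ ((|b₁| + 1) ^ i * (i.factorial : ℝ) * ((|b₂| + 1) ^ j * (j.factorial : ℝ)) *
          ((|b₃| + 1) ^ k * (k.factorial : ℝ)) * ((|b₄| + 1) ^ l * (l.factorial : ℝ))) /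
        (e ^ (i + j + k + l) *
          ((i.factorial : ℝ) * j.factorial * k.factorial * l.factorial)) *
        ((|x₁| ^ i / (i.factorial : ℝ)) * (|x₂| ^ j / (j.factorial : ℝ)) *
          (|x₃| ^ k / (k.factorial : ℝ)) * (|x₄| ^ l / (l.factorial : ℝ))) := by
        gcongr <;> apply hb
    _ = _ := by
        simp only [g, div_pow, mul_pow, pow_add]
        field_simp

/-- The coefficient `C_q^n = binom(n, q) * binom(2n - 2q, n)` of the Legendre polynomial. -/
def legendreCoeff (n q : ℕ) : ℕ := n.choose q * (2 * n - 2 * q).choose n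

/-- `√((m + μK)² - μ²K²Δ²)`. -/
noncomputable def mftrRoot (m : ℕ) (μ K Δ : ℝ) : ℝ :=
  √(((m : ℝ) + μ * K) ^ 2 - μ ^ 2 * K ^ 2 * Δ ^ 2)

/-- The closed form of the PDF of the SNR at `x > 0`, `γbar` being the average SNR. -/
noncomputable def mftrPDF (m : ℕ) (μ K Δ γbar x : ℝ) : ℝ :=
  (1 + K) ^ μ * μ ^ μ / (2 ^ (m - 1) * Real.Gamma μ * γbar ^ μ) *
    ((m : ℝ) / mftrRoot m μ K Δ) ^ m *
    ∑ q ∈ Finset.range ((m - 1) / 2 + 1),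
      (-1 : ℝ) ^ q * (legendreCoeff (m - 1) q : ℝ) *
        (((m : ℝ) + μ * K) / mftrRoot m μ K Δ) ^ (m - 1 - 2 * q) *
        x ^ (μ - 1) *
        phi2Four (1 + 2 * (q : ℝ) - m) ((m : ℝ) - q - 1 / 2) ((m : ℝ) - q - 1 / 2) (μ - m) μ
          (-((1 + K) * m * μ / (((m : ℝ) + μ * K) * γbar)) * x)
          (-((1 + K) * m * μ / (((m : ℝ) + μ * K * (1 + Δ)) * γbar)) * x)
          (-((1 + K) * m * μ / (((m : ℝ) + μ * K * (1 - Δ)) * γbar)) * x)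
          (-((1 + K) * μ / γbar) * x)

/-- The closed form of the CDF of the SNR at `x ≥ 0`, `γbar` being the average SNR. -/
noncomputable def mftrCDF (m : ℕ) (μ K Δ γbar x : ℝ) : ℝ :=
  (1 + K) ^ μ * μ ^ μ / (2 ^ (m - 1) * Real.Gamma (μ + 1) * γbar ^ μ) *
    ((m : ℝ) / mftrRoot m μ K Δ) ^ m *
    ∑ q ∈ Finset.range ((m - 1) / 2 + 1),
      (-1 : ℝ) ^ q * (legendreCoeff (m - 1) q : ℝ) *
        (((m : ℝ) + μ * K) / mftrRoot m μ K Δ) ^ (m - 1 - 2 * q) *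
        x ^ μ *
        phi2Four (1 + 2 * (q : ℝ) - m) ((m : ℝ) - q - 1 / 2) ((m : ℝ) - q - 1 / 2) (μ - m) (μ + 1)
          (-((1 + K) * m * μ / (((m : ℝ) + μ * K) * γbar)) * x)
          (-((1 + K) * m * μ / (((m : ℝ) + μ * K * (1 + Δ)) * γbar)) * x)
          (-((1 + K) * m * μ / (((m : ℝ) + μ * K * (1 - Δ)) * γbar)) * x)
          (-((1 + K) * μ / γbar) * x)

/-- The law `ν` on the line is concentrated on `(0, ∞)`, has there the (measurable, nonnegative)
density `f` with respect to Lebesgue measure, and its distribution function is `F` on `[0, ∞)`. -/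
def HasPDFAndCDF (ν : Measure ℝ) (f F : ℝ → ℝ) : Prop :=
  (∀ x, 0 < x → 0 ≤ f x) ∧
  Measurable (fun x => if 0 < x then f x else 0) ∧
  ν = volume.withDensity (fun x => ENNReal.ofReal (if 0 < x then f x else 0)) ∧
  ∀ x, 0 ≤ x → ν.real (Set.Iic x) = F x

/-- The uniform distribution on `(0, 2π)`. -/
noncomputable def uniformPhase : Measure ℝ := cond volume (Set.Ioo 0 (2 * Real.pi))

/-! ### The physical model: a positive integer number `n + 1` of clusters -/

/-- Names of the elementary random variables of the model with `n` clusters besides the first. -/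
inductive MFTRSource (n : ℕ) : Type
  | shadow : MFTRSource n
  | phase₁ : MFTRSource n
  | phase₂ : MFTRSource n
  | phase (i : Fin n) : MFTRSource n
  | re (i : Fin (n + 1)) : MFTRSource n
  | im (i : Fin (n + 1)) : MFTRSource n

/-- The elementary random variables of the model: the shadowing `ζ` is Gamma distributed with
shape `m` and mean one, the phases are uniform on `(0, 2π)`, the real and imaginary parts
of the diffuse components are centred Gaussian with variance `σ²`, and all are independent. -/
structure IsMFTRModel {Ω : Type*} [MeasurableSpace Ω] (P : Measure Ω) (n : ℕ) (m σ : ℝ)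
    (ξ : MFTRSource n → Ω → ℝ) : Prop where
  law_shadow : HasLaw (ξ .shadow) (gammaMeasure m m) P
  law_phase₁ : HasLaw (ξ .phase₁) uniformPhase P
  law_phase₂ : HasLaw (ξ .phase₂) uniformPhase P
  law_phase : ∀ i, HasLaw (ξ (.phase i)) uniformPhase P
  law_re : ∀ i, HasLaw (ξ (.re i)) (gaussianReal 0 (σ ^ 2).toNNReal) P
  law_im : ∀ i, HasLaw (ξ (.im i)) (gaussianReal 0 (σ ^ 2).toNNReal) P
  indep : iIndepFun ξ P

/-- The received power `W = R²`: two specular components of amplitudes `V₁`, `V₂` in the first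
cluster, one of amplitude `U i` in each of the `n` additional clusters. -/
noncomputable def mftrPower {Ω : Type*} {n : ℕ} (V₁ V₂ : ℝ) (U : Fin n → ℝ)
    (ξ : MFTRSource n → Ω → ℝ) (ω : Ω) : ℝ :=
  ‖(√(ξ .shadow ω) : ℂ) * ((V₁ : ℂ) * Complex.exp (Complex.I * (ξ .phase₁ ω : ℂ)) +
        (V₂ : ℂ) * Complex.exp (Complex.I * (ξ .phase₂ ω : ℂ))) +
      ((ξ (.re 0) ω : ℂ) + Complex.I * (ξ (.im 0) ω : ℂ))‖ ^ 2 +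
  ∑ i : Fin n,
    ‖(√(ξ .shadow ω) : ℂ) * ((U i : ℂ) * Complex.exp (Complex.I * (ξ (.phase i) ω : ℂ))) +
      ((ξ (.re i.succ) ω : ℂ) + Complex.I * (ξ (.im i.succ) ω : ℂ))‖ ^ 2

/-- The parameter `K`: specular power over diffuse power. -/
noncomputable def mftrK {n : ℕ} (V₁ V₂ : ℝ) (U : Fin n → ℝ) (σ : ℝ) : ℝ :=
  (V₁ ^ 2 + V₂ ^ 2 + ∑ i, U i ^ 2) / (2 * σ ^ 2 * ((n : ℝ) + 1))

/-- The parameter `Δ`. If there is no specular power at all, then `K = 0`, the law does not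
depend on `Δ`, and the value here is `0`. -/
noncomputable def mftrDelta {n : ℕ} (V₁ V₂ : ℝ) (U : Fin n → ℝ) : ℝ :=
  2 * V₁ * V₂ / (V₁ ^ 2 + V₂ ^ 2 + ∑ i, U i ^ 2)

/-! ### The generalized model: a positive real parameter `μ` -/

/-- The `κ`-`μ` power law (the noncentral chi-square law with `2μ` degrees of freedom, `μ > 0`
real, up to scale), as the Poisson mixture of Gamma laws. Its density at `x > 0` is
`∑_j e^{-δ} δ^j / j! * r^{μ+j} x^{μ+j-1} e^{-rx} / Γ(μ+j)`, that is
`r (r x / δ)^{(μ-1)/2} e^{-δ - r x} I_{μ-1}(2 √(δ r x))` if `δ > 0`. -/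
noncomputable def kappaMuPowerLaw (μ δ r : ℝ) : Measure ℝ :=
  (poissonMeasure δ.toNNReal).bind fun j => gammaMeasure (μ + j) r

/-- The `κ`-`μ` shadowed law with mean `γbar`: the specular power of a `κ`-`μ` law is multiplied
by a Gamma distributed variable `z` of shape `m` and mean one. -/
noncomputable def kappaMuShadowedLaw (κ μ m γbar : ℝ) : Measure ℝ :=
  (gammaMeasure m m).bind fun z => kappaMuPowerLaw μ (z * (μ * κ)) (μ * (1 + κ) / γbar)

/-- The law of the SNR under MFTR fading with parameters `K, m, μ, Δ` and average SNR `γbar`: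
given the phase difference `θ` of the two specular components of the first cluster, which is
uniform on `(0, 2π)`, the SNR is `κ`-`μ` shadowed with `κ_θ = K (1 + Δ cos θ)` and with the mean
`γbar_θ` for which `(1 + κ_θ) / γbar_θ = (1 + K) / γbar`. -/
noncomputable def mftrLaw (m μ K Δ γbar : ℝ) : Measure ℝ :=
  uniformPhase.bind fun θ =>
    kappaMuShadowedLaw (K * (1 + Δ * Real.cos θ)) μ m
      (γbar * (1 + K * (1 + Δ * Real.cos θ)) / (1 + K))

/-! Both models are identified through the Laplace transform. With r = (1+K)μ/γ̄ and κ_θ = K(1+Δ cos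
θ), the transform of the SNR at s is (r/(r+s))^μ times the average over θ of (m/(m+μκ_θ s/(r+s)))^m.
In the generalized model this comes from mixing Gamma transforms over the Poisson variable and then
over the shadowing. In the physical model one integrates out the Gaussians given the specular
components; only ζ and φ₁-φ₂, uniform modulo 2π, survive, and E[γ] is exactly what makes the
parameters match. Both models therefore feed the criterion `hasPDFAndCDF_of_lintegral_laplace`.

Clearing r+s turns the average into one of (A+B cos θ)^(-m), with A = (m+μK)s+mr and B = μKΔs.
Laplace's second integral (`integral_inv_add_mul_cos_pow`) evaluates it by the Legendre polynomial
P_{m-1} at A/√(A²-B²), whose expansion is the sum over q. Since A, A+B, A-B and r+s are linear in s,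
each summand is, up to a constant, s^(-μ) times a product of four powers of 1+a_i/s. By the binomial
series this product is the Laplace transform of x^(μ-1)Φ₂⁽⁴⁾/Γ(μ), which is
`laplace_rpow_mul_phi2Four`.

That last computation is carried out for large s only. This suffices: by
`eq_withDensity_of_laplace`, agreement along s₀, s₀+1, s₀+2, … determines the law, and it yields
nonnegativity of the density, which is not visible in the alternating sum. The distribution function
follows by termwise integration, which raises the parameter c to c+1. -/

/-! ### Uniqueness from a discrete set of Laplace transform values -/

/-- Two finite measures on `[0, 1]` with the same moments coincide. -/
theorem ext_of_moments_of_ae_mem_Icc {ν₁ ν₂ : Measure ℝ} [IsFiniteMeasure ν₁] [IsFiniteMeasure ν₂]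
    (h₁ : ∀ᵐ x ∂ν₁, x ∈ Set.Icc (0 : ℝ) 1) (h₂ : ∀ᵐ x ∂ν₂, x ∈ Set.Icc (0 : ℝ) 1)
    (h : ∀ n : ℕ, ∫ x, x ^ n ∂ν₁ = ∫ x, x ^ n ∂ν₂) : ν₁ = ν₂ := by
  have h_int : ∀ {ν : Measure ℝ} [IsFiniteMeasure ν], (∀ᵐ x ∂ν, x ∈ Set.Icc (0 : ℝ) 1) →
      ∀ g : ℝ → ℝ, Continuous g → Integrable g ν := by
    intro ν _ hν g hg
    obtain ⟨C, hC⟩ := isCompact_Icc.exists_bound_of_continuousOn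
      (hg.continuousOn (s := Set.Icc (0 : ℝ) 1))
    exact Integrable.of_bound hg.aestronglyMeasurable C (hν.mono fun x hx => hC x hx)
  have hpoly : ∀ p : Polynomial ℝ, ∫ x, p.eval x ∂ν₁ = ∫ x, p.eval x ∂ν₂ := by
    intro p
    simp only [Polynomial.eval_eq_sum_range]
    rw [integral_finsetSum _ fun i _ => h_int h₁ _ (by fun_prop),
      integral_finsetSum _ fun i _ => h_int h₂ _ (by fun_prop)]
    simp only [integral_const_mul, h]
  apply ext_of_forall_integral_eq_of_IsFiniteMeasure
  intro f
  have hf := f.continuous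
  refine eq_of_forall_dist_le fun ε hε => ?_
  -- The approximation error ε/M is integrated against both measures; the summand 1 keeps M positive
  -- when both vanish.
  set M := ν₁.real Set.univ + ν₂.real Set.univ + 1 with hM
  have hMpos : 0 < M := by positivity
  obtain ⟨p, hp⟩ := exists_polynomial_near_of_continuousOn 0 1 f hf.continuousOn (ε / M)
    (by positivity)
  have key : ∀ {ν : Measure ℝ} [IsFiniteMeasure ν], (∀ᵐ x ∂ν, x ∈ Set.Icc (0 : ℝ) 1) →
      ‖∫ x, (f x - p.eval x) ∂ν‖ ≤ ε / M * ν.real Set.univ := by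
    intro ν _ hν
    refine norm_integral_le_of_norm_le_const (hν.mono fun x hx => ?_)
    rw [Real.norm_eq_abs, abs_sub_comm]
    exact (hp x hx).le
  have k₁ := key h₁
  have k₂ := key h₂
  rw [integral_sub (h_int h₁ _ hf) (h_int h₁ _ p.continuous)] at k₁
  rw [integral_sub (h_int h₂ _ hf) (h_int h₂ _ p.continuous), ← hpoly p] at k₂
  rw [Real.dist_eq]
  have hsum : ε / M * ν₁.real Set.univ + ε / M * ν₂.real Set.univ ≤ ε := by
    rw [← mul_add, div_mul_eq_mul_div, div_le_iff₀ hMpos]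
    nlinarith
  rw [Real.norm_eq_abs, abs_le] at k₁ k₂
  rw [abs_le]
  constructor <;> linarith [k₁.1, k₁.2, k₂.1, k₂.2]

/-- A finite measure on `[0, ∞)` is determined by the values of its Laplace transform at the
natural numbers. -/
theorem ext_of_integral_exp_neg_nat {ν₁ ν₂ : Measure ℝ} [IsFiniteMeasure ν₁] [IsFiniteMeasure ν₂]
    (h₁ : ∀ᵐ x ∂ν₁, 0 ≤ x) (h₂ : ∀ᵐ x ∂ν₂, 0 ≤ x)
    (h : ∀ n : ℕ, ∫ x, Real.exp (-(n * x)) ∂ν₁ = ∫ x, Real.exp (-(n * x)) ∂ν₂) : ν₁ = ν₂ := by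
  -- Pushing forward by exp(-x) turns the transform at n into the n-th moment of a measure on [0,
  -- 1]; -log recovers the original measure.
  have he : Measurable fun x : ℝ => Real.exp (-x) := by fun_prop
  have hl : Measurable fun x : ℝ => -Real.log x := by fun_prop
  have hmem : ∀ {ν : Measure ℝ}, (∀ᵐ x ∂ν, 0 ≤ x) →
      ∀ᵐ y ∂(ν.map fun x => Real.exp (-x)), y ∈ Set.Icc (0 : ℝ) 1 := by
    intro ν hν
    refine (ae_map_iff he.aemeasurable measurableSet_Icc).2 ?_
    filter_upwards [hν] with x hx
    exact ⟨(Real.exp_pos _).le, Real.exp_le_one_iff.2 (by linarith)⟩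
  have hmom : ∀ (ν : Measure ℝ) (n : ℕ), ∫ y, y ^ n ∂(ν.map fun x => Real.exp (-x)) =
      ∫ x, Real.exp (-(n * x)) ∂ν := by
    intro ν n
    rw [integral_map he.aemeasurable (by fun_prop)]
    refine integral_congr_ae (Filter.Eventually.of_forall fun x => ?_)
    simp only [← Real.exp_nat_mul, mul_neg]
  have hback : ∀ ν : Measure ℝ, (ν.map fun x => Real.exp (-x)).map (fun x => -Real.log x) = ν := by
    intro ν
    rw [Measure.map_map hl he]
    convert Measure.map_id
    ext x
    simp
  rw [← hback ν₁, ← hback ν₂, ext_of_moments_of_ae_mem_Icc (hmem h₁) (hmem h₂)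
    fun n => by rw [hmom, hmom, h]]

/-- A finite measure on `[0, ∞)` whose Laplace transform agrees at `s`, `s + 1`, `s + 2`, … with
that of a continuous function `f` on `(0, ∞)` has the density `f`, and `f` is nonnegative. -/
theorem eq_withDensity_of_laplace {ν : Measure ℝ} [IsFiniteMeasure ν] (h0 : ∀ᵐ x ∂ν, 0 ≤ x)
    {f : ℝ → ℝ} (hf : ContinuousOn f (Set.Ioi 0)) {s : ℝ} (hs : 0 ≤ s)
    (h_int : IntegrableOn (fun x => Real.exp (-(s * x)) * f x) (Set.Ioi 0))
    (h : ∀ n : ℕ, ∫ x, Real.exp (-((s + n) * x)) ∂ν =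
      ∫ x in Set.Ioi 0, Real.exp (-((s + n) * x)) * f x) :
    (∀ x, 0 < x → 0 ≤ f x) ∧
    ν = volume.withDensity (fun x => ENNReal.ofReal (if 0 < x then f x else 0)) := by
  set g : ℝ → ℝ := fun x => Real.exp (-(s * x)) * f x with hg
  set lam : Measure ℝ := volume.restrict (Set.Ioi 0) with hlam
  have hgm : AEMeasurable g lam := h_int.aestronglyMeasurable.aemeasurable
  -- The tilt by exp(-sx) makes the candidate integrable. As its sign is unknown, its positive and
  -- negative parts become two measures, and the claim takes the form ν' + ρm = ρp between genuine
  -- finite measures.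
  set ν' : Measure ℝ := ν.withDensity fun x => ENNReal.ofReal (Real.exp (-(s * x))) with hν'
  set ρp : Measure ℝ := lam.withDensity fun x => ENNReal.ofReal (g x) with hρp
  set ρm : Measure ℝ := lam.withDensity fun x => ENNReal.ofReal (-g x) with hρm
  have hfinp : IsFiniteMeasure ρp := isFiniteMeasure_withDensity_ofReal h_int.hasFiniteIntegral
  have hfinm : IsFiniteMeasure ρm := isFiniteMeasure_withDensity_ofReal h_int.neg.hasFiniteIntegral
  have hexpint : Integrable (fun x => Real.exp (-(s * x))) ν := by
    refine Integrable.of_bound (by fun_prop) 1 (h0.mono fun x hx => ?_)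
    rw [Real.norm_eq_abs, Real.abs_exp]
    exact Real.exp_le_one_iff.2 (by nlinarith)
  have hfin' : IsFiniteMeasure ν' := isFiniteMeasure_withDensity_ofReal hexpint.hasFiniteIntegral
  have hlam0 : ∀ᵐ x ∂lam, 0 ≤ x := by
    filter_upwards [ae_restrict_mem measurableSet_Ioi] with x hx using le_of_lt hx
  have hp0 : ∀ᵐ x ∂ρp, 0 ≤ x := (withDensity_absolutelyContinuous _ _).ae_le hlam0
  have hm0 : ∀ᵐ x ∂ρm, 0 ≤ x := (withDensity_absolutelyContinuous _ _).ae_le hlam0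
  have hν0 : ∀ᵐ x ∂ν', 0 ≤ x := (withDensity_absolutelyContinuous _ _).ae_le h0
  have hbint : ∀ {ρ : Measure ℝ} [IsFiniteMeasure ρ], (∀ᵐ x ∂ρ, 0 ≤ x) → ∀ n : ℕ,
      Integrable (fun x => Real.exp (-(n * x))) ρ := by
    intro ρ _ hρ n
    refine Integrable.of_bound (by fun_prop) 1 (hρ.mono fun x hx => ?_)
    rw [Real.norm_eq_abs, Real.abs_exp]
    exact Real.exp_le_one_iff.2 (by have : (0 : ℝ) ≤ n * x := by positivity
                                    linarith)
  have hgint : ∀ n : ℕ, Integrable (fun x => Real.exp (-(n * x)) * g x) lam := by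
    intro n
    refine Integrable.bdd_mul (c := 1) h_int (by fun_prop) (hlam0.mono fun x hx => ?_)
    rw [Real.norm_eq_abs, Real.abs_exp]
    exact Real.exp_le_one_iff.2 (by have : (0 : ℝ) ≤ n * x := by positivity
                                    linarith)
  have hmain : ν' + ρm = ρp := by
    refine ext_of_integral_exp_neg_nat (ae_add_measure_iff.2 ⟨hν0, hm0⟩) hp0 fun n => ?_
    rw [integral_add_measure (hbint hν0 n) (hbint hm0 n)]
    rw [integral_withDensity_eq_integral_toReal_smul₀ (by fun_prop) (by simp),
      integral_withDensity_eq_integral_toReal_smul₀ (by fun_prop) (by simp),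
      integral_withDensity_eq_integral_toReal_smul₀ (by fun_prop) (by simp)]
    have e1 : ∫ x, (ENNReal.ofReal (Real.exp (-(s * x)))).toReal • Real.exp (-(n * x)) ∂ν =
        ∫ x, Real.exp (-(n * x)) * g x ∂lam := by
      have : ∀ x : ℝ, Real.exp (-((s + n) * x)) = Real.exp (-(s * x)) * Real.exp (-(n * x)) := by
        intro x; rw [← Real.exp_add]; ring_nf
      have hn := h n
      simp only [this] at hn
      simp only [ENNReal.toReal_ofReal (Real.exp_pos _).le, smul_eq_mul]
      rw [hn]
      refine integral_congr_ae (Filter.Eventually.of_forall fun x => ?_)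
      simp only [hg]; ring
    have hi : ∀ {k : ℝ → ℝ}, AEMeasurable k lam → (∀ x, |k x| = |g x|) →
        Integrable (fun x => (ENNReal.ofReal (k x)).toReal • Real.exp (-(n * x))) lam := by
      intro k hk hkg
      refine (hgint n).mono (by fun_prop) (Filter.Eventually.of_forall fun x => ?_)
      rw [smul_eq_mul, norm_mul, norm_mul, mul_comm]
      gcongr
      rw [Real.norm_eq_abs, Real.norm_eq_abs, ← hkg x, abs_of_nonneg ENNReal.toReal_nonneg]
      rcases le_total 0 (k x) with hx | hx
      · rw [ENNReal.toReal_ofReal hx]; exact le_abs_self _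
      · rw [ENNReal.ofReal_of_nonpos hx]; simp
    rw [e1, ← integral_add (hgint n) (hi (k := fun x => -g x) hgm.neg fun x => by simp)]
    refine integral_congr_ae (Filter.Eventually.of_forall fun x => ?_)
    simp only [smul_eq_mul]
    rcases le_total 0 (g x) with hx | hx
    · rw [ENNReal.toReal_ofReal hx, ENNReal.ofReal_of_nonpos (by linarith : -g x ≤ 0)]
      simp; ring
    · rw [ENNReal.toReal_ofReal (by linarith : 0 ≤ -g x), ENNReal.ofReal_of_nonpos hx]
      simp; ring
  -- On the set where f < 0 the measure ρp vanishes, hence so does the smaller ρm. That set is then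
  -- Lebesgue null, and being open by continuity of f it is empty: f is nonnegative everywhere, not
  -- just almost everywhere.
  have hopen : IsOpen (Set.Ioi 0 ∩ f ⁻¹' Set.Iio 0) := hf.isOpen_inter_preimage isOpen_Ioi isOpen_Iio
  set N := Set.Ioi 0 ∩ f ⁻¹' Set.Iio 0 with hN
  have hpN : ρp N = 0 := by
    rw [hρp, withDensity_apply _ hopen.measurableSet, setLIntegral_congr_fun hopen.measurableSet
      (g := fun _ => 0), lintegral_zero]
    intro x hx
    exact ENNReal.ofReal_of_nonpos
      (mul_nonpos_of_nonneg_of_nonpos (Real.exp_pos _).le (le_of_lt hx.2))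
  have hmN : ρm N = 0 := by
    have : ρm N ≤ (ν' + ρm) N := by simp
    rw [hmain, hpN] at this
    exact le_antisymm this bot_le
  have hvN : volume N = 0 := by
    rw [hρm, withDensity_apply_eq_zero' (by fun_prop)] at hmN
    rw [hlam, Measure.restrict_apply₀' (by measurability)] at hmN
    refine measure_mono_null ?_ hmN
    intro x hx
    refine ⟨⟨?_, hx⟩, hx.1⟩
    have := mul_pos (Real.exp_pos (-(s * x))) (neg_pos.2 hx.2)
    simp only [hg, Set.mem_ofPred_eq, ne_eq, ENNReal.ofReal_eq_zero, not_le]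
    linarith
  have hNe : N = ∅ := (hopen.measure_eq_zero_iff volume).1 hvN
  have hpos : ∀ x, 0 < x → 0 ≤ f x := by
    intro x hx
    by_contra hneg
    have : x ∈ N := ⟨hx, not_le.1 hneg⟩
    simp [hNe] at this
  refine ⟨hpos, ?_⟩
  have hρm0 : ρm = 0 := by
    rw [hρm, withDensity_eq_zero_iff (by fun_prop)]
    filter_upwards [ae_restrict_mem measurableSet_Ioi] with x hx
    exact ENNReal.ofReal_of_nonpos
      (neg_nonpos.2 (mul_nonneg (Real.exp_pos _).le (hpos x hx)))
  rw [hρm0, add_zero] at hmain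
  have hE : Measurable fun x : ℝ => ENNReal.ofReal (Real.exp (-(s * x))) := by fun_prop
  have hE' : Measurable fun x : ℝ => ENNReal.ofReal (Real.exp (s * x)) := by fun_prop
  have hcancel : ∀ x : ℝ, ENNReal.ofReal (Real.exp (-(s * x))) * ENNReal.ofReal (Real.exp (s * x))
      = 1 := by
    intro x
    rw [← ENNReal.ofReal_mul (Real.exp_pos _).le, ← Real.exp_add]; simp
  have hback : ν'.withDensity (fun x => ENNReal.ofReal (Real.exp (s * x))) = ν := by
    rw [hν', ← withDensity_mul _ hE hE']
    convert withDensity_one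
    ext x
    simp [hcancel]
  rw [← hback, hmain, hρp, ← withDensity_mul₀ (by fun_prop) (by fun_prop), hlam,
    ← withDensity_indicator measurableSet_Ioi]
  congr 1
  ext x
  by_cases hx : 0 < x
  · simp only [hx, if_true, Set.indicator, Set.mem_Ioi, Pi.mul_apply, hg]
    rw [ENNReal.ofReal_mul (Real.exp_pos _).le, mul_right_comm, hcancel, one_mul]
  · simp [Set.indicator, hx]

/-! ### Legendre coefficients and Bonnet's recurrence -/

/-- Putting n = 2q+j removes truncated subtraction and makes the coefficient a quotient of
factorials, so that neighbouring coefficients can be compared by cancelling. -/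
theorem legendreCoeff_mul_factorial (q j : ℕ) :
    legendreCoeff (2 * q + j) q * (q.factorial * (q + j).factorial * j.factorial) =
      (2 * q + 2 * j).factorial := by
  have h₁ := Nat.choose_mul_factorial_mul_factorial (n := 2 * q + j) (k := q) (by omega)
  have h₂ := Nat.choose_mul_factorial_mul_factorial (n := 2 * q + 2 * j) (k := 2 * q + j) (by omega)
  rw [show 2 * q + j - q = q + j by omega] at h₁
  rw [show 2 * q + 2 * j - (2 * q + j) = j by omega] at h₂
  rw [legendreCoeff, show 2 * (2 * q + j) - 2 * q = 2 * q + 2 * j by omega]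
  calc _ = (2 * q + 2 * j).choose (2 * q + j) *
        ((2 * q + j).choose q * q.factorial * (q + j).factorial) * j.factorial := by ring
    _ = _ := by rw [h₁, h₂]

/-- One of the two binomials has its lower index above its upper one. Sums over q can thus be
extended to a common range. -/
theorem legendreCoeff_eq_zero {n q : ℕ} (h : n < 2 * q) : legendreCoeff n q = 0 := by
  rw [legendreCoeff]
  rcases lt_or_ge n q with hq | hq
  · rw [Nat.choose_eq_zero_of_lt hq, zero_mul]
  · rcases Nat.eq_zero_or_pos n with rfl | hn
    · omega
    · rw [Nat.choose_eq_zero_of_lt (show 2 * n - 2 * q < n by omega), mul_zero]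

theorem legendreCoeff_succ_zero (n : ℕ) :
    (n + 1) * legendreCoeff (n + 1) 0 = 2 * (2 * n + 1) * legendreCoeff n 0 := by
  simpa [legendreCoeff, Nat.centralBinom] using Nat.succ_mul_centralBinom_succ n

/-- Bonnet's recurrence read off coefficientwise, without signs and powers of 2 in the
normalization. For n = 2q+j, after multiplication by q+1 both other coefficients are polynomial
multiples of the one at (n, q), which leaves a polynomial identity in q and j. -/
theorem legendreCoeff_recurrence (n q : ℕ) :
    (n + 2) * legendreCoeff (n + 2) (q + 1) =
      2 * (2 * n + 3) * legendreCoeff (n + 1) (q + 1) + 4 * (n + 1) * legendreCoeff n q := by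
  rcases lt_or_ge n (2 * q) with h | h
  · rw [legendreCoeff_eq_zero h, legendreCoeff_eq_zero (show n + 1 < 2 * (q + 1) by omega),
      legendreCoeff_eq_zero (show n + 2 < 2 * (q + 1) by omega)]
    simp
  obtain ⟨j, rfl⟩ := Nat.exists_eq_add_of_le h
  have h₀ := legendreCoeff_mul_factorial q j
  have h₂ := legendreCoeff_mul_factorial (q + 1) j
  rw [show 2 * (q + 1) + j = 2 * q + j + 2 by ring,
    show q + 1 + j = q + j + 1 by ring,
    show 2 * (q + 1) + 2 * j = 2 * q + 2 * j + 1 + 1 by ring, Nat.factorial_succ (q + j),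
    Nat.factorial_succ (2 * q + 2 * j + 1), Nat.factorial_succ (2 * q + 2 * j),
    Nat.factorial_succ q, ← h₀] at h₂
  have hq := Nat.factorial_pos q
  have hj := Nat.factorial_pos j
  have hqj := Nat.factorial_pos (q + j)
  have e₂ : (q + 1) * legendreCoeff (2 * q + j + 2) (q + 1) =
      2 * (2 * q + 2 * j + 1) * legendreCoeff (2 * q + j) q := by
    have hpos : 0 < (q + j + 1) * (q.factorial * (q + j).factorial * j.factorial) := by positivity
    refine Nat.eq_of_mul_eq_mul_right hpos ?_
    calc _ = _ := by rw [← mul_assoc]; ring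
      _ = _ := h₂
      _ = _ := by ring
  have e₁ : (q + 1) * legendreCoeff (2 * q + j + 1) (q + 1) =
      j * legendreCoeff (2 * q + j) q := by
    rcases j with _ | i
    · rw [legendreCoeff_eq_zero (show 2 * q + 0 + 1 < 2 * (q + 1) by omega)]; simp
    · have h₁ := legendreCoeff_mul_factorial (q + 1) i
      rw [show 2 * (q + 1) + i = 2 * q + (i + 1) + 1 by ring,
        show q + 1 + i = q + (i + 1) by ring,
        show 2 * (q + 1) + 2 * i = 2 * q + 2 * (i + 1) by ring, ← h₀, Nat.factorial_succ q,
        Nat.factorial_succ i] at h₁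
      have hi := Nat.factorial_pos i
      have hpos : 0 < q.factorial * (q + (i + 1)).factorial * i.factorial := by positivity
      refine Nat.eq_of_mul_eq_mul_right hpos ?_
      calc _ = _ := by ring
        _ = _ := h₁
        _ = _ := by ring
  refine Nat.eq_of_mul_eq_mul_left (show 0 < q + 1 by omega) ?_
  calc (q + 1) * ((2 * q + j + 2) * legendreCoeff (2 * q + j + 2) (q + 1))
      = (2 * q + j + 2) * ((q + 1) * legendreCoeff (2 * q + j + 2) (q + 1)) := by ring
    _ = 2 * (2 * (2 * q + j) + 3) * (j * legendreCoeff (2 * q + j) q) +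
        (q + 1) * (4 * (2 * q + j + 1) * legendreCoeff (2 * q + j) q) := by rw [e₂]; ring
    _ = _ := by rw [← e₁]; ring

/-- `2 ^ n * √D ^ n * Pₙ(A / √D)` for the Legendre polynomial `Pₙ`, as a polynomial in `A`, `D`. -/
noncomputable def legendreHom (n : ℕ) (A D : ℝ) : ℝ :=
  ∑ q ∈ Finset.range (n / 2 + 1), (-1 : ℝ) ^ q * (legendreCoeff n q : ℝ) * A ^ (n - 2 * q) * D ^ q

theorem legendreHom_eq_sum_range {n N : ℕ} (h : n / 2 + 1 ≤ N) (A D : ℝ) :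
    legendreHom n A D =
      ∑ q ∈ Finset.range N, (-1 : ℝ) ^ q * (legendreCoeff n q : ℝ) * A ^ (n - 2 * q) * D ^ q := by
  refine Finset.sum_subset (Finset.range_mono h) fun q _ hq => ?_
  rw [legendreCoeff_eq_zero (by rw [Finset.mem_range] at hq; omega)]
  simp

theorem legendreHom_zero (A D : ℝ) : legendreHom 0 A D = 1 := by
  simp [legendreHom, legendreCoeff]

theorem legendreHom_one (A D : ℝ) : legendreHom 1 A D = 2 * A := by
  simp [legendreHom, legendreCoeff]

theorem legendreHom_add_two (n : ℕ) (A D : ℝ) :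
    (n + 2) * legendreHom (n + 2) A D =
      2 * (2 * n + 3) * A * legendreHom (n + 1) A D - 4 * (n + 1) * D * legendreHom n A D := by
  -- Padding with zero terms lets index q+1 of the first two sums face index q of the third; the q =
  -- 0 terms are split off.
  rw [legendreHom_eq_sum_range (n := n + 2) (N := n + 3) (by omega),
    legendreHom_eq_sum_range (n := n + 1) (N := n + 3) (by omega),
    legendreHom_eq_sum_range (n := n) (N := n + 2) (by omega),
    Finset.sum_range_succ' _ (n + 2), Finset.sum_range_succ' _ (n + 2), mul_add, mul_add,
    Finset.mul_sum, Finset.mul_sum, Finset.mul_sum, add_sub_right_comm, ← Finset.sum_sub_distrib]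
  congr 1
  · refine Finset.sum_congr rfl fun q _ => ?_
    have hrec : ((n : ℝ) + 2) * (legendreCoeff (n + 2) (q + 1) : ℝ) =
        2 * (2 * n + 3) * (legendreCoeff (n + 1) (q + 1) : ℝ) +
          4 * (n + 1) * (legendreCoeff n q : ℝ) := by
      exact_mod_cast legendreCoeff_recurrence n q
    -- The exponents disagree when the subtraction truncates, but there the coefficient is zero.
    have hA : (legendreCoeff (n + 1) (q + 1) : ℝ) * (A * A ^ (n + 1 - 2 * (q + 1))) =
        (legendreCoeff (n + 1) (q + 1) : ℝ) * A ^ (n - 2 * q) := by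
      rcases lt_or_ge (n + 1) (2 * (q + 1)) with h | h
      · rw [legendreCoeff_eq_zero h]; simp
      · rw [← pow_succ', show n + 1 - 2 * (q + 1) + 1 = n - 2 * q by omega]
    rw [show n + 2 - 2 * (q + 1) = n - 2 * q by omega, pow_succ (-1 : ℝ), pow_succ D]
    linear_combination (-1) ^ q * (-1) * A ^ (n - 2 * q) * D ^ q * D * hrec -
      2 * (2 * n + 3) * (-1) ^ q * (-1) * D ^ q * D * hA
  · have hrec : ((n : ℝ) + 2) * (legendreCoeff (n + 2) 0 : ℝ) =
        2 * (2 * n + 3) * (legendreCoeff (n + 1) 0 : ℝ) := by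
      have := legendreCoeff_succ_zero (n + 1)
      have h2 : ((n : ℝ) + 1 + 1) * (legendreCoeff (n + 2) 0 : ℝ) =
        2 * (2 * (n + 1) + 1) * (legendreCoeff (n + 1) 0 : ℝ) := by exact_mod_cast this
      linear_combination h2
    simp only [mul_zero, Nat.sub_zero, pow_zero, one_mul, mul_one]
    rw [pow_succ A (n + 1)]
    linear_combination A ^ (n + 1) * A * hrec

/-! ### Laplace's second integral for (A + B cos θ)^(-n-1) -/

section CosIntegral

variable {A B : ℝ}

theorem add_mul_cos_pos (h : |B| < A) (θ : ℝ) : 0 < A + B * Real.cos θ := by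
  have h₁ : |B * Real.cos θ| ≤ |B| := by
    rw [abs_mul]
    exact mul_le_of_le_one_right (abs_nonneg _) (Real.abs_cos_le_one θ)
  linarith [neg_abs_le (B * Real.cos θ)]

theorem intervalIntegrable_inv_add_mul_cos_pow (h : |B| < A) (k : ℕ) (a b : ℝ) :
    IntervalIntegrable (fun θ => ((A + B * Real.cos θ) ^ k)⁻¹) volume a b := by
  refine Continuous.intervalIntegrable ?_ a b
  exact Continuous.inv₀ (by fun_prop) fun θ => (pow_pos (add_mul_cos_pos h θ) k).ne'

/-- An antiderivative smooth on the whole line is used, in place of the half-angle one that jumps at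
π. Its arctangent vanishes at both endpoints, so only θ/d contributes. -/
theorem integral_inv_add_mul_cos (h : |B| < A) :
    ∫ θ in 0..2 * Real.pi, ((A + B * Real.cos θ) ^ 1)⁻¹ = 2 * Real.pi / √(A ^ 2 - B ^ 2) := by
  have hA : 0 < A := (abs_nonneg B).trans_lt h
  have hD : 0 < A ^ 2 - B ^ 2 := by
    have := sq_lt_sq' (by linarith [abs_nonneg B]) h
    rw [sq_abs] at this
    linarith
  set d := √(A ^ 2 - B ^ 2) with hd
  have hdpos : 0 < d := Real.sqrt_pos.2 hD
  have hdsq : d ^ 2 = A ^ 2 - B ^ 2 := Real.sq_sqrt hD.le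
  have hc : |B| < A + d := by linarith
  have hder : ∀ θ : ℝ, HasDerivAt
      (fun θ => (θ - 2 * Real.arctan (B * Real.sin θ / (A + d + B * Real.cos θ))) / d)
      (((A + B * Real.cos θ) ^ 1)⁻¹) θ := by
    intro θ
    have hu := add_mul_cos_pos h θ
    have hv := add_mul_cos_pos hc θ
    have h₁ := (((Real.hasDerivAt_sin θ).const_mul B).div
      (((Real.hasDerivAt_cos θ).const_mul B).const_add (A + d)) hv.ne').arctan
    have h₂ := (((hasDerivAt_id θ).sub (h₁.const_mul 2)).div_const d)
    refine h₂.congr_deriv ?_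
    simp only [Pi.div_apply]
    have hsc := Real.sin_sq_add_cos_sq θ
    have hw : (A + d + B * Real.cos θ) ^ 2 + (B * Real.sin θ) ^ 2 =
        2 * (A + d) * (A + B * Real.cos θ) := by
      linear_combination B ^ 2 * hsc + hdsq
    have hAd : 0 < A + d := by linarith
    have h1 : 1 + (B * Real.sin θ / (A + d + B * Real.cos θ)) ^ 2 =
        2 * (A + d) * (A + B * Real.cos θ) / (A + d + B * Real.cos θ) ^ 2 := by
      rw [← hw]; field_simp
    rw [h1]
    field_simp
    linear_combination -(B ^ 2 * hsc) - hdsq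
  rw [intervalIntegral.integral_eq_sub_of_hasDerivAt (fun θ _ => hder θ)
    (intervalIntegrable_inv_add_mul_cos_pow h 1 _ _)]
  simp

/-- B sin θ/(A+B cos θ)^(m+1) takes the same value at 0 and 2π, and its derivative is a combination
of three consecutive inverse powers. -/
theorem integral_inv_add_mul_cos_pow_recurrence (h : |B| < A) (m : ℕ) :
    (m + 1) * (A ^ 2 - B ^ 2) * ∫ θ in 0..2 * Real.pi, ((A + B * Real.cos θ) ^ (m + 2))⁻¹ =
      (2 * m + 1) * A * (∫ θ in 0..2 * Real.pi, ((A + B * Real.cos θ) ^ (m + 1))⁻¹) -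
        m * ∫ θ in 0..2 * Real.pi, ((A + B * Real.cos θ) ^ m)⁻¹ := by
  have hi := fun k => intervalIntegrable_inv_add_mul_cos_pow h k 0 (2 * Real.pi)
  have hder : ∀ θ : ℝ, HasDerivAt (fun θ => B * Real.sin θ / (A + B * Real.cos θ) ^ (m + 1))
      ((2 * m + 1) * A * ((A + B * Real.cos θ) ^ (m + 1))⁻¹ - m * ((A + B * Real.cos θ) ^ m)⁻¹ -
        (m + 1) * (A ^ 2 - B ^ 2) * ((A + B * Real.cos θ) ^ (m + 2))⁻¹) θ := by
    intro θ
    have hu := add_mul_cos_pos h θ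
    have h₁ := ((Real.hasDerivAt_sin θ).const_mul B).div
      ((((Real.hasDerivAt_cos θ).const_mul B).const_add A).pow (m + 1)) (pow_pos hu _).ne'
    refine h₁.congr_deriv ?_
    have hsc := Real.sin_sq_add_cos_sq θ
    simp only [Pi.pow_apply, Nat.add_sub_cancel, Nat.cast_add, Nat.cast_one, pow_succ]
    field_simp
    linear_combination ((m + 1) * B ^ 2) * hsc
  have hz := intervalIntegral.integral_eq_sub_of_hasDerivAt (fun θ _ => hder θ)
    ((((hi (m + 1)).const_mul _).sub ((hi m).const_mul _)).sub ((hi (m + 2)).const_mul _))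
  rw [intervalIntegral.integral_sub (((hi (m + 1)).const_mul _).sub ((hi m).const_mul _))
    ((hi (m + 2)).const_mul _), intervalIntegral.integral_sub ((hi (m + 1)).const_mul _)
    ((hi m).const_mul _), intervalIntegral.integral_const_mul, intervalIntegral.integral_const_mul,
    intervalIntegral.integral_const_mul] at hz
  simp only [Real.sin_two_pi, Real.sin_zero, mul_zero, zero_div, sub_zero] at hz
  linarith

/-- Laplace's second integral for the Legendre polynomials. -/
theorem integral_inv_add_mul_cos_pow (h : |B| < A) (n : ℕ) :
    ∫ θ in 0..2 * Real.pi, ((A + B * Real.cos θ) ^ (n + 1))⁻¹ =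
      2 * Real.pi * legendreHom n A (A ^ 2 - B ^ 2) /
        (2 ^ n * (A ^ 2 - B ^ 2) ^ n * √(A ^ 2 - B ^ 2)) := by
  have hD : 0 < A ^ 2 - B ^ 2 := by
    have := sq_lt_sq' (by linarith [abs_nonneg B]) h
    rw [sq_abs] at this
    linarith
  have hd := Real.sqrt_pos.2 hD
  -- The integral recurrence and Bonnet's recurrence are the same after scaling, so only n = 0 and n
  -- = 1 need evaluation.
  induction n using Nat.twoStepInduction with
  | zero => rw [zero_add, integral_inv_add_mul_cos h, legendreHom_zero]; simp
  | one =>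
    have := integral_inv_add_mul_cos_pow_recurrence h 0
    rw [zero_add, zero_add, integral_inv_add_mul_cos h] at this
    rw [legendreHom_one, eq_div_iff (by positivity)]
    simp only [Nat.cast_zero, zero_add, one_mul, mul_zero, zero_mul, sub_zero] at this
    field_simp at this ⊢
    linear_combination this
  | more n ih₁ ih₂ =>
    have h₁ := integral_inv_add_mul_cos_pow_recurrence h (n + 1)
    have h₂ := legendreHom_add_two n A (A ^ 2 - B ^ 2)
    rw [ih₁, ih₂] at h₁
    rw [eq_div_iff (by positivity)]
    have hn : (n : ℝ) + 2 ≠ 0 := by positivity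
    refine mul_left_cancel₀ hn ?_
    push_cast at h₁
    rw [show n + 1 + 2 = n + 2 + 1 by ring, show n + 1 + 1 = n + 2 by ring] at h₁
    generalize A ^ 2 - B ^ 2 = D at *
    generalize ∫ θ in 0..2 * Real.pi, ((A + B * Real.cos θ) ^ (n + 2 + 1))⁻¹ = J at *
    simp only [pow_succ] at h₁ ⊢
    field_simp at h₁
    linear_combination 4 * h₁ - 2 * Real.pi * h₂

end CosIntegral

/-! ### Termwise integration of power series against x^(c-1) -/

section Series

variable {ι : Type*}

theorem integrable_tsum_of_summable_integral_norm [Countable ι] {α : Type*} [MeasurableSpace α] {lam : Measure α}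
    {F : ι → α → ℝ} (hF : ∀ i, Integrable (F i) lam) (hsum : Summable fun i => ∫ a, ‖F i a‖ ∂lam)
    (hm : AEStronglyMeasurable (fun a => ∑' i, F i a) lam) :
    Integrable (fun a => ∑' i, F i a) lam := by
  refine ⟨hm, ?_⟩
  have h₁ : ∀ i, ∫⁻ a, ‖F i a‖ₑ ∂lam = ENNReal.ofReal (∫ a, ‖F i a‖ ∂lam) := by
    intro i
    rw [ofReal_integral_norm_eq_lintegral_enorm (hF i)]
  calc ∫⁻ a, ‖∑' i, F i a‖ₑ ∂lam ≤ ∫⁻ a, ∑' i, ‖F i a‖ₑ ∂lam :=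
        lintegral_mono fun a => enorm_tsum_le_tsum_enorm
    _ = ∑' i, ENNReal.ofReal (∫ a, ‖F i a‖ ∂lam) := by
        rw [lintegral_tsum fun i => (hF i).aestronglyMeasurable.enorm]
        simp only [h₁]
    _ < ⊤ := hsum.tsum_ofReal_lt_top

/-- Weierstrass test on a ball of radius |x|+1. The degree function `d` may repeat values, which
accommodates multi-indices graded by total degree. -/
theorem continuous_tsum_mul_pow {T : ι → ℝ} {d : ι → ℕ}
    (hT : ∀ R : ℝ, Summable fun k => T k * R ^ d k) :
    Continuous fun x : ℝ => ∑' k, T k * x ^ d k := by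
  rw [continuous_iff_continuousAt]
  intro x
  have hon : ContinuousOn (fun x : ℝ => ∑' k, T k * x ^ d k) (Metric.ball 0 (|x| + 1)) := by
    refine continuousOn_tsum (u := fun k => |T k * (|x| + 1) ^ d k|) (fun k => by fun_prop)
      (hT _).abs fun k y hy => ?_
    have hy' : |y| ≤ |x| + 1 := by
      rw [mem_ball_zero_iff] at hy; exact hy.le
    rw [Real.norm_eq_abs, abs_mul, abs_mul, abs_pow, abs_pow,
      abs_of_nonneg (by positivity : (0 : ℝ) ≤ |x| + 1)]
    gcongr
  exact hon.continuousAt (Metric.isOpen_ball.mem_nhds (by simp))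

theorem laplace_rpow_mul_tsum [Countable ι] {T : ι → ℝ} {d : ι → ℕ} {c s : ℝ} (hc : 0 < c) (hs : 0 < s)
    (hT : ∀ R : ℝ, Summable fun k => T k * R ^ d k)
    (hsum : Summable fun k => |T k| * ((1 / s) ^ (c + d k) * Real.Gamma (c + d k))) :
    IntegrableOn (fun x => Real.exp (-(s * x)) * (x ^ (c - 1) * ∑' k, T k * x ^ d k))
      (Set.Ioi 0) ∧
    ∫ x in Set.Ioi 0, Real.exp (-(s * x)) * (x ^ (c - 1) * ∑' k, T k * x ^ d k) =
      ∑' k, T k * ((1 / s) ^ (c + d k) * Real.Gamma (c + d k)) := by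
  set lam : Measure ℝ := volume.restrict (Set.Ioi 0) with hlam
  have hpos : ∀ᵐ x ∂lam, 0 < x := ae_restrict_mem measurableSet_Ioi
  let F : ι → ℝ → ℝ := fun k x => T k * (x ^ (c + d k - 1) * Real.exp (-(s * x)))
  have hcd : ∀ k, 0 < c + (d k : ℝ) := fun k => by positivity
  have hval := fun k => Real.integral_rpow_mul_exp_neg_mul_Ioi (hcd k) hs
  have h_int : ∀ k, Integrable (fun x : ℝ => x ^ (c + d k - 1) * Real.exp (-(s * x))) lam := by
    intro k
    -- A non-integrable function has Bochner integral zero, whereas the Gamma integral is positive.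
    refine Integrable.of_integral_ne_zero ?_
    rw [hlam, hval]
    have := Real.Gamma_pos_of_pos (hcd k)
    positivity
  have hF : ∀ k, Integrable (F k) lam := fun k => (h_int k).const_mul _
  have hFn : ∀ k, ∫ x, ‖F k x‖ ∂lam = |T k| * ((1 / s) ^ (c + d k) * Real.Gamma (c + d k)) := by
    intro k
    rw [← hval k, ← integral_const_mul]
    refine integral_congr_ae (hpos.mono fun x hx => ?_)
    simp only [F, norm_mul, Real.norm_eq_abs, Real.abs_exp, abs_of_nonneg (Real.rpow_nonneg hx.le _)]
  have hcongr : (fun x => Real.exp (-(s * x)) * (x ^ (c - 1) * ∑' k, T k * x ^ d k)) =ᵐ[lam]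
      fun x => ∑' k, F k x := by
    filter_upwards [hpos] with x hx
    rw [← tsum_mul_left, ← tsum_mul_left]
    refine tsum_congr fun k => ?_
    simp only [F]
    rw [show c + d k - 1 = c - 1 + d k by ring, Real.rpow_add hx, Real.rpow_natCast]
    ring
  have hmeas : AEStronglyMeasurable
      (fun x => Real.exp (-(s * x)) * (x ^ (c - 1) * ∑' k, T k * x ^ d k)) lam := by
    have := (continuous_tsum_mul_pow hT).measurable
    exact Measurable.aestronglyMeasurable (by fun_prop)
  have hs' : Summable fun k => ∫ x, ‖F k x‖ ∂lam := by simpa only [hFn] using hsum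
  refine ⟨(integrable_tsum_of_summable_integral_norm hF hs' (hmeas.congr hcongr)).congr
    hcongr.symm, ?_⟩
  rw [integral_congr_ae hcongr, ← integral_tsum_of_summable_integral_norm hF hs']
  refine tsum_congr fun k => ?_
  rw [integral_const_mul, hlam, hval]

/-- No extra summability is needed: integration divides each term by c + d k ≥ c, so the given
series dominates. -/
theorem intervalIntegral_rpow_mul_tsum [Countable ι] {T : ι → ℝ} {d : ι → ℕ} {c x : ℝ}
    (hc : 0 < c) (hx : 0 ≤ x)
    (hT : ∀ R : ℝ, Summable fun k => T k * R ^ d k) :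
    IntervalIntegrable (fun t => t ^ (c - 1) * ∑' k, T k * t ^ d k) volume 0 x ∧
    ∫ t in 0..x, t ^ (c - 1) * ∑' k, T k * t ^ d k =
      x ^ c * ∑' k, T k / (c + d k) * x ^ d k := by
  have hcont := continuous_tsum_mul_pow hT
  have hcd : ∀ k, 0 < c + (d k : ℝ) := fun k => by positivity
  refine ⟨(intervalIntegral.intervalIntegrable_rpow' (by linarith)).mul_continuousOn
    hcont.continuousOn, ?_⟩
  rw [intervalIntegral.integral_of_le hx]
  set lam : Measure ℝ := volume.restrict (Set.Ioc 0 x) with hlam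
  have hpos : ∀ᵐ t ∂lam, 0 < t :=
    (ae_restrict_mem measurableSet_Ioc).mono fun t ht => ht.1
  let F : ι → ℝ → ℝ := fun k t => T k * t ^ (c + d k - 1)
  have h_int : ∀ k, Integrable (fun t : ℝ => t ^ (c + d k - 1)) lam := fun k =>
    (intervalIntegrable_iff_integrableOn_Ioc_of_le hx).1
      (intervalIntegral.intervalIntegrable_rpow' (by linarith [hcd k]))
  have hval : ∀ k, ∫ t, t ^ (c + d k - 1) ∂lam = x ^ (c + d k) / (c + d k) := by
    intro k
    rw [hlam, ← intervalIntegral.integral_of_le hx, integral_rpow (Or.inl (by linarith [hcd k])),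
      show c + d k - 1 + 1 = c + d k by ring, Real.zero_rpow (hcd k).ne', sub_zero]
  have hF : ∀ k, Integrable (F k) lam := fun k => (h_int k).const_mul _
  have hxc : ∀ k, x ^ (c + d k) = x ^ c * x ^ d k := by
    intro k
    rw [Real.rpow_add' hx (hcd k).ne', Real.rpow_natCast]
  have hFn : ∀ k, ∫ t, ‖F k t‖ ∂lam = |T k| * (x ^ (c + d k) / (c + d k)) := by
    intro k
    rw [← hval k, ← integral_const_mul]
    refine integral_congr_ae (hpos.mono fun t ht => ?_)
    simp only [F, norm_mul, Real.norm_eq_abs, abs_of_nonneg (Real.rpow_nonneg ht.le _)]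
  have hs' : Summable fun k => ∫ t, ‖F k t‖ ∂lam := by
    simp only [hFn]
    refine Summable.of_nonneg_of_le (fun k => by have := hcd k; positivity) (fun k => ?_)
      ((hT x).abs.mul_left (x ^ c / c))
    rw [hxc, abs_mul, abs_of_nonneg (pow_nonneg hx _)]
    have : x ^ c * x ^ d k / (c + d k) ≤ x ^ c * x ^ d k / c := by
      gcongr
      linarith [(Nat.cast_nonneg (d k) : (0 : ℝ) ≤ d k)]
    calc _ ≤ |T k| * (x ^ c * x ^ d k / c) := by gcongr
      _ = _ := by ring
  calc ∫ t, t ^ (c - 1) * ∑' k, T k * t ^ d k ∂lam = ∫ t, ∑' k, F k t ∂lam := by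
        refine integral_congr_ae (hpos.mono fun t ht => ?_)
        simp only [F]
        rw [← tsum_mul_left]
        refine tsum_congr fun k => ?_
        rw [show c + d k - 1 = c - 1 + d k by ring, Real.rpow_add ht, Real.rpow_natCast]
        ring
    _ = _ := by
        rw [← integral_tsum_of_summable_integral_norm hF hs', ← tsum_mul_left]
        refine tsum_congr fun k => ?_
        rw [integral_const_mul, hval, hxc]
        ring

end Series

/-! ### Binomial series and the Laplace transform of Φ₂⁽⁴⁾ -/

theorem hasSum_ascPochhammer_mul_pow (b : ℝ) {z : ℝ} (hz : |z| < 1) :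
    HasSum (fun k : ℕ => (ascPochhammer ℝ k).eval b * z ^ k / (k.factorial : ℝ))
      ((1 - z) ^ (-b)) := by
  have h := (Real.one_div_one_sub_rpow_hasFPowerSeriesOnBall_zero b).hasSum (y := z)
    (by simpa [enorm_eq_nnnorm, ← NNReal.coe_lt_coe] using hz)
  have hpos : 0 < 1 - z := by linarith [le_abs_self z]
  rw [Real.rpow_neg hpos.le, ← one_div]
  simp only [zero_add, FormalMultilinearSeries.ofScalars_apply_eq] at h
  refine h.congr_fun fun k => ?_
  have hk : (k.factorial : ℝ) * Ring.choose (b + k - 1) k = (ascPochhammer ℝ k).eval b := by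
    rw [Ring.choose, show b + k - 1 - k + 1 = b by ring, ← nsmul_eq_mul,
      Ring.factorial_nsmul_multichoose_eq_ascPochhammer, ← Polynomial.aeval_eq_smeval,
      Polynomial.aeval_def, ← Polynomial.eval_map, ascPochhammer_map]
  rw [← hk]
  have : (k.factorial : ℝ) ≠ 0 := by positivity
  simp only [smul_eq_mul]
  field_simp

/-- A geometric majorant. The condition is stronger than |z| < 1 but costs nothing, since z = a/s
with s as large as desired. -/
theorem summable_abs_ascPochhammer_mul_pow {b z : ℝ} (hz : (|b| + 1) * |z| < 1) :
    Summable fun k : ℕ => |(ascPochhammer ℝ k).eval b * z ^ k / (k.factorial : ℝ)| := by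
  refine Summable.of_nonneg_of_le (fun k => abs_nonneg _) (fun k => ?_)
    (summable_geometric_of_lt_one (by positivity) hz)
  have h := abs_ascPochhammer_eval_le b k
  have hk : (0 : ℝ) < k.factorial := by positivity
  rw [abs_div, abs_mul, abs_pow, Nat.abs_cast, div_le_iff₀ hk, mul_pow]
  calc _ ≤ (|b| + 1) ^ k * (k.factorial : ℝ) * |z| ^ k := by gcongr
    _ = _ := by ring

theorem Gamma_add_natCast {c : ℝ} (hc : 0 < c) (n : ℕ) :
    Real.Gamma (c + n) = (ascPochhammer ℝ n).eval c * Real.Gamma c := by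
  induction n with
  | zero => simp
  | succ n ih =>
    rw [Nat.cast_succ, ← add_assoc, Real.Gamma_add_one (by positivity), ih, ascPochhammer_succ_eval]
    ring

/-- Total degree of a multi-index. -/
def multiDegree (k : ℕ × ℕ × ℕ × ℕ) : ℕ := k.1 + k.2.1 + k.2.2.1 + k.2.2.2

section Phi

variable (b₁ b₂ b₃ b₄ : ℝ)

/-- The factors of a term of `Φ₂⁽⁴⁾` other than the denominator `(c)_{k₁+k₂+k₃+k₄}`. -/
noncomputable def phi2Weight (a₁ a₂ a₃ a₄ : ℝ) (k : ℕ × ℕ × ℕ × ℕ) : ℝ :=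
  ((ascPochhammer ℝ k.1).eval b₁ * a₁ ^ k.1 / (k.1.factorial : ℝ)) *
    (((ascPochhammer ℝ k.2.1).eval b₂ * a₂ ^ k.2.1 / (k.2.1.factorial : ℝ)) *
    (((ascPochhammer ℝ k.2.2.1).eval b₃ * a₃ ^ k.2.2.1 / (k.2.2.1.factorial : ℝ)) *
    ((ascPochhammer ℝ k.2.2.2).eval b₄ * a₄ ^ k.2.2.2 / (k.2.2.2.factorial : ℝ))))

theorem phi2Term_eq_phi2Weight_div (c a₁ a₂ a₃ a₄ : ℝ) (k : ℕ × ℕ × ℕ × ℕ) :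
    phi2Term b₁ b₂ b₃ b₄ c a₁ a₂ a₃ a₄ k =
      phi2Weight b₁ b₂ b₃ b₄ a₁ a₂ a₃ a₄ k / (ascPochhammer ℝ (multiDegree k)).eval c := by
  rw [phi2Term, phi2Weight, multiDegree]
  generalize (ascPochhammer ℝ (k.1 + k.2.1 + k.2.2.1 + k.2.2.2)).eval c = C
  generalize (ascPochhammer ℝ k.1).eval b₁ = B₁
  generalize (ascPochhammer ℝ k.2.1).eval b₂ = B₂
  generalize (ascPochhammer ℝ k.2.2.1).eval b₃ = B₃
  generalize (ascPochhammer ℝ k.2.2.2).eval b₄ = B₄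
  ring

theorem phi2Weight_mul (a₁ a₂ a₃ a₄ x : ℝ) (k : ℕ × ℕ × ℕ × ℕ) :
    phi2Weight b₁ b₂ b₃ b₄ (a₁ * x) (a₂ * x) (a₃ * x) (a₄ * x) k =
      phi2Weight b₁ b₂ b₃ b₄ a₁ a₂ a₃ a₄ k * x ^ multiDegree k := by
  rw [phi2Weight, phi2Weight, multiDegree]
  generalize (ascPochhammer ℝ k.1).eval b₁ = B₁
  generalize (ascPochhammer ℝ k.2.1).eval b₂ = B₂
  generalize (ascPochhammer ℝ k.2.2.1).eval b₃ = B₃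
  generalize (ascPochhammer ℝ k.2.2.2).eval b₄ = B₄
  simp only [mul_pow, pow_add]
  ring

theorem phi2Term_mul (c a₁ a₂ a₃ a₄ x : ℝ) (k : ℕ × ℕ × ℕ × ℕ) :
    phi2Term b₁ b₂ b₃ b₄ c (a₁ * x) (a₂ * x) (a₃ * x) (a₄ * x) k =
      phi2Term b₁ b₂ b₃ b₄ c a₁ a₂ a₃ a₄ k * x ^ multiDegree k := by
  rw [phi2Term_eq_phi2Weight_div, phi2Term_eq_phi2Weight_div, phi2Weight_mul]
  ring

theorem phi2Four_mul (c a₁ a₂ a₃ a₄ x : ℝ) :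
    phi2Four b₁ b₂ b₃ b₄ c (a₁ * x) (a₂ * x) (a₃ * x) (a₄ * x) =
      ∑' k, phi2Term b₁ b₂ b₃ b₄ c a₁ a₂ a₃ a₄ k * x ^ multiDegree k :=
  tsum_congr fun k => phi2Term_mul b₁ b₂ b₃ b₄ c a₁ a₂ a₃ a₄ x k

theorem summable_phi2Term_mul_pow {c : ℝ} (hc : 0 < c) (a₁ a₂ a₃ a₄ x : ℝ) :
    Summable fun k => phi2Term b₁ b₂ b₃ b₄ c a₁ a₂ a₃ a₄ k * x ^ multiDegree k := by
  simpa only [← phi2Term_mul] using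
    summable_phi2Term b₁ b₂ b₃ b₄ c (a₁ * x) (a₂ * x) (a₃ * x) (a₄ * x) hc

theorem continuous_phi2Four_mul {c : ℝ} (hc : 0 < c) (a₁ a₂ a₃ a₄ : ℝ) :
    Continuous fun x => phi2Four b₁ b₂ b₃ b₄ c (a₁ * x) (a₂ * x) (a₃ * x) (a₄ * x) := by
  simp only [phi2Four_mul]
  exact continuous_tsum_mul_pow (summable_phi2Term_mul_pow b₁ b₂ b₃ b₄ hc a₁ a₂ a₃ a₄)

/-- A term of degree d is divided by c+d, and (c)_d (c+d) = c (c+1)_d. -/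
theorem intervalIntegral_rpow_mul_phi2Four {c x : ℝ} (hc : 0 < c) (hx : 0 ≤ x)
    (a₁ a₂ a₃ a₄ : ℝ) :
    IntervalIntegrable (fun t => t ^ (c - 1) *
      phi2Four b₁ b₂ b₃ b₄ c (a₁ * t) (a₂ * t) (a₃ * t) (a₄ * t)) volume 0 x ∧
    ∫ t in 0..x, t ^ (c - 1) * phi2Four b₁ b₂ b₃ b₄ c (a₁ * t) (a₂ * t) (a₃ * t) (a₄ * t) =
      x ^ c / c * phi2Four b₁ b₂ b₃ b₄ (c + 1) (a₁ * x) (a₂ * x) (a₃ * x) (a₄ * x) := by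
  simp only [phi2Four_mul]
  have h := intervalIntegral_rpow_mul_tsum hc hx
    (summable_phi2Term_mul_pow b₁ b₂ b₃ b₄ hc a₁ a₂ a₃ a₄)
  refine ⟨h.1, h.2.trans ?_⟩
  rw [← tsum_mul_left, ← tsum_mul_left]
  refine tsum_congr fun k => ?_
  have h₁ := ascPochhammer_succ_eval (S := ℝ) (multiDegree k) c
  have h₂ : (ascPochhammer ℝ (multiDegree k + 1)).eval c =
      c * (ascPochhammer ℝ (multiDegree k)).eval (c + 1) := by
    simp [ascPochhammer_succ_left, Polynomial.eval_comp]
  have h₃ := ascPochhammer_pos (multiDegree k) c hc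
  have h₄ := ascPochhammer_pos (multiDegree k) (c + 1) (by linarith)
  have h₅ : (0 : ℝ) < c + multiDegree k := by positivity
  rw [h₁] at h₂
  have h₆ : (ascPochhammer ℝ (multiDegree k)).eval c =
      c * (ascPochhammer ℝ (multiDegree k)).eval (c + 1) / (c + multiDegree k) := by
    rw [eq_div_iff h₅.ne', h₂]
  rw [phi2Term_eq_phi2Weight_div, phi2Term_eq_phi2Weight_div, h₆]
  field_simp

/-- Γ(c+d) = (c)_d Γ(c) cancels the denominator, the only factor that couples the four indices. -/
theorem phi2Term_mul_Gamma {c s : ℝ} (hc : 0 < c) (hs : 0 < s) (a₁ a₂ a₃ a₄ : ℝ)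
    (k : ℕ × ℕ × ℕ × ℕ) :
    phi2Term b₁ b₂ b₃ b₄ c a₁ a₂ a₃ a₄ k *
        ((1 / s) ^ (c + multiDegree k) * Real.Gamma (c + multiDegree k)) =
      Real.Gamma c * (1 / s) ^ c *
        phi2Weight b₁ b₂ b₃ b₄ (a₁ / s) (a₂ / s) (a₃ / s) (a₄ / s) k := by
  have h₃ := ascPochhammer_pos (multiDegree k) c hc
  rw [Gamma_add_natCast hc, Real.rpow_add (by positivity), Real.rpow_natCast,
    phi2Term_eq_phi2Weight_div]
  rw [div_eq_mul_one_div a₁ s, div_eq_mul_one_div a₂ s, div_eq_mul_one_div a₃ s,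
    div_eq_mul_one_div a₄ s, phi2Weight_mul]
  field_simp

/-- Once the indices are decoupled, the quadruple series is a product of four absolutely convergent
binomial series. -/
theorem laplace_rpow_mul_phi2Four {c s : ℝ} (hc : 0 < c) (hs : 0 < s) {a₁ a₂ a₃ a₄ : ℝ}
    (h₁ : (|b₁| + 1) * |a₁| < s) (h₂ : (|b₂| + 1) * |a₂| < s) (h₃ : (|b₃| + 1) * |a₃| < s)
    (h₄ : (|b₄| + 1) * |a₄| < s) :
    IntegrableOn (fun x => Real.exp (-(s * x)) * (x ^ (c - 1) *
      phi2Four b₁ b₂ b₃ b₄ c (a₁ * x) (a₂ * x) (a₃ * x) (a₄ * x))) (Set.Ioi 0) ∧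
    ∫ x in Set.Ioi 0, Real.exp (-(s * x)) * (x ^ (c - 1) *
      phi2Four b₁ b₂ b₃ b₄ c (a₁ * x) (a₂ * x) (a₃ * x) (a₄ * x)) =
      Real.Gamma c * (1 / s) ^ c * ((1 - a₁ / s) ^ (-b₁) * ((1 - a₂ / s) ^ (-b₂) *
        ((1 - a₃ / s) ^ (-b₃) * (1 - a₄ / s) ^ (-b₄)))) := by
  have hz : ∀ {b a : ℝ}, (|b| + 1) * |a| < s → (|b| + 1) * |a / s| < 1 := by
    intro b a h
    rw [abs_div, abs_of_pos hs, ← mul_div_assoc, div_lt_one hs]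
    exact h
  have hz' : ∀ {b a : ℝ}, (|b| + 1) * |a| < s → |a / s| < 1 := by
    intro b a h
    refine lt_of_le_of_lt ?_ (hz h)
    nlinarith [abs_nonneg b, abs_nonneg (a / s), mul_nonneg (abs_nonneg b) (abs_nonneg (a / s))]
  let g : ℝ → ℝ → ℕ → ℝ := fun b a k =>
    (ascPochhammer ℝ k).eval b * (a / s) ^ k / (k.factorial : ℝ)
  have hn : ∀ {b a : ℝ}, (|b| + 1) * |a| < s → Summable fun k => ‖g b a k‖ := fun h =>
    summable_abs_ascPochhammer_mul_pow (hz h)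
  have hv : ∀ {b a : ℝ}, (|b| + 1) * |a| < s → ∑' k, g b a k = (1 - a / s) ^ (-b) := fun h =>
    (hasSum_ascPochhammer_mul_pow _ (hz' h)).tsum_eq
  have n34 := (hn h₃).mul_norm (hn h₄)
  have n234 := (hn h₂).mul_norm n34
  have n1234 := (hn h₁).mul_norm n234
  have hval : ∑' k : ℕ × ℕ × ℕ × ℕ, g b₁ a₁ k.1 * (g b₂ a₂ k.2.1 *
      (g b₃ a₃ k.2.2.1 * g b₄ a₄ k.2.2.2)) =
      (1 - a₁ / s) ^ (-b₁) * ((1 - a₂ / s) ^ (-b₂) *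
        ((1 - a₃ / s) ^ (-b₃) * (1 - a₄ / s) ^ (-b₄))) := by
    rw [← hv h₁, ← hv h₂, ← hv h₃, ← hv h₄, tsum_mul_tsum_of_summable_norm (hn h₃) (hn h₄),
      tsum_mul_tsum_of_summable_norm (hn h₂) n34, tsum_mul_tsum_of_summable_norm (hn h₁) n234]
  have hterm := phi2Term_mul_Gamma b₁ b₂ b₃ b₄ hc hs a₁ a₂ a₃ a₄
  have hΓ := Real.Gamma_pos_of_pos hc
  simp only [phi2Four_mul]
  have hsum : Summable fun k => |phi2Term b₁ b₂ b₃ b₄ c a₁ a₂ a₃ a₄ k| *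
      ((1 / s) ^ (c + multiDegree k) * Real.Gamma (c + multiDegree k)) := by
    refine (n1234.mul_left (Real.Gamma c * (1 / s) ^ c)).congr fun k => ?_
    have hΓk := Real.Gamma_pos_of_pos (show 0 < c + (multiDegree k : ℝ) by positivity)
    rw [← abs_of_pos (show 0 < (1 / s) ^ (c + multiDegree k) * Real.Gamma (c + multiDegree k) by
      positivity), ← abs_mul, hterm, abs_mul (Real.Gamma c * (1 / s) ^ c),
      abs_of_pos (show 0 < Real.Gamma c * (1 / s) ^ c by positivity), Real.norm_eq_abs]
    rfl
  obtain ⟨hi, he⟩ := laplace_rpow_mul_tsum hc hs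
    (summable_phi2Term_mul_pow b₁ b₂ b₃ b₄ hc a₁ a₂ a₃ a₄) hsum
  refine ⟨hi, he.trans ?_⟩
  simp only [hterm]
  rw [tsum_mul_left, ← hval]
  rfl

end Phi

/-- Here X₂ and X₃ stand for 1+a₂/s and 1+a₃/s. Their exponents are equal, so only their product
enters, and this is D up to a square; the half-integer exponent produces √D. The first exponent is
the natural number j, so that factor is a plain power. -/
theorem legendre_laplace_term {q j : ℕ} {M S s A D X₂ X₃ : ℝ} (hM : 0 < M) (hS : 0 < S)
    (hs : 0 < s) (hA : 0 < A) (hD : 0 < D) (hX₂ : 0 < X₂) (hX₃ : 0 < X₃)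
    (hX : X₂ * X₃ = D / (S * s) ^ 2) {b₁ b₂ : ℝ} (hb₁ : -b₁ = j) (hb₂ : b₂ = (q + j : ℕ) + 1 / 2) :
    (M / S) ^ j * ((A / (M * s)) ^ (-b₁) * (X₂ ^ (-b₂) * X₃ ^ (-b₂))) =
      (S * s) ^ (2 * q + j + 1) * (A ^ j * D ^ q) / (D ^ (2 * q + j) * √D) := by
  have hd := Real.sqrt_pos.2 hD
  have hDd : D = √D ^ 2 := (Real.sq_sqrt hD.le).symm
  have hw : 0 < S * s := mul_pos hS hs
  rw [hb₁, Real.rpow_natCast, ← Real.mul_rpow hX₂.le hX₃.le, hX, hb₂, Real.rpow_neg (by positivity),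
    Real.rpow_add (by positivity), Real.rpow_natCast, ← Real.sqrt_eq_rpow, Real.sqrt_div hD.le,
    Real.sqrt_sq hw.le]
  set d := √D with hdd
  rw [hDd]
  simp only [pow_add, mul_pow, div_pow, ← pow_mul, pow_one]
  field_simp
  ring

theorem hasPDFAndCDF_of_withDensity {ν : Measure ℝ} [IsFiniteMeasure ν] {f F : ℝ → ℝ}
    (hf : ContinuousOn f (Set.Ioi 0)) (hpos : ∀ x, 0 < x → 0 ≤ f x)
    (hν : ν = volume.withDensity (fun x => ENNReal.ofReal (if 0 < x then f x else 0)))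
    (hF : ∀ x, 0 ≤ x → ∫ t in 0..x, f t = F x) : HasPDFAndCDF ν f F := by
  have hm : Measurable (fun x => if 0 < x then f x else 0) := by
    exact hf.measurable_piecewise continuousOn_const measurableSet_Ioi
  refine ⟨hpos, hm, hν, fun x hx => ?_⟩
  have hnn : ∀ t, 0 ≤ if 0 < t then f t else 0 := fun t => by
    split_ifs with h
    · exact hpos t h
    · exact le_rfl
  rw [← hF x hx, measureReal_def, hν, withDensity_apply _ measurableSet_Iic,
    ← integral_eq_lintegral_of_nonneg_ae (Filter.Eventually.of_forall hnn)
      hm.aestronglyMeasurable.restrict, intervalIntegral.integral_of_le hx]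
  have h₁ : ∀ t, (if 0 < t then f t else 0) = (Set.Ioi 0).indicator f t := fun t => by
    simp [Set.indicator]
  simp only [h₁]
  rw [integral_indicator measurableSet_Ioi, Measure.restrict_restrict measurableSet_Ioi,
    Set.Ioi_inter_Iic]

/-! ### The closed form has the required Laplace transform -/

section Density

variable {m : ℕ} {μ K Δ γbar : ℝ}

theorem mftrRoot_pos (hm : 0 < m) (hμ : 0 < μ) (hK : 0 ≤ K) (hΔ : 0 ≤ Δ) (hΔ' : Δ ≤ 1) :
    0 < mftrRoot m μ K Δ ∧
      mftrRoot m μ K Δ ^ 2 = ((m : ℝ) + μ * K * (1 + Δ)) * (m + μ * K * (1 - Δ)) := by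
  have hm' : (0 : ℝ) < m := Nat.cast_pos.2 hm
  have h1 : 0 ≤ 1 - Δ := by linarith
  have he : ((m : ℝ) + μ * K) ^ 2 - μ ^ 2 * K ^ 2 * Δ ^ 2 =
      ((m : ℝ) + μ * K * (1 + Δ)) * (m + μ * K * (1 - Δ)) := by ring
  have hp : 0 < ((m : ℝ) + μ * K * (1 + Δ)) * (m + μ * K * (1 - Δ)) := by positivity
  rw [mftrRoot, he]
  exact ⟨Real.sqrt_pos.2 hp, Real.sq_sqrt hp.le⟩

theorem continuousOn_mftrPDF (hμ : 0 < μ) :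
    ContinuousOn (mftrPDF m μ K Δ γbar) (Set.Ioi 0) := by
  unfold mftrPDF
  refine continuousOn_const.mul (continuousOn_finsetSum _ fun q _ => ?_)
  refine (continuousOn_const.mul ?_).mul (continuous_phi2Four_mul _ _ _ _ hμ _ _ _ _).continuousOn
  exact continuousOn_id.rpow_const fun x hx => Or.inl (ne_of_gt hx)

theorem intervalIntegral_mftrPDF (hμ : 0 < μ) {x : ℝ} (hx : 0 ≤ x) :
    ∫ t in 0..x, mftrPDF m μ K Δ γbar t = mftrCDF m μ K Δ γbar x := by
  unfold mftrPDF mftrCDF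
  simp only [mul_assoc _ (_ ^ (μ - 1)) (phi2Four _ _ _ _ _ _ _ _ _)]
  have hI := fun b₁ b₂ b₃ b₄ a₁ a₂ a₃ a₄ =>
    intervalIntegral_rpow_mul_phi2Four b₁ b₂ b₃ b₄ hμ hx a₁ a₂ a₃ a₄
  rw [intervalIntegral.integral_const_mul, intervalIntegral.integral_finsetSum
    fun q _ => (hI _ _ _ _ _ _ _ _).1.const_mul _]
  simp only [intervalIntegral.integral_const_mul, (hI _ _ _ _ _ _ _ _).2]
  have hΓ := (Real.Gamma_pos_of_pos hμ).ne'
  rw [Real.Gamma_add_one hμ.ne', Finset.mul_sum, Finset.mul_sum]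
  refine Finset.sum_congr rfl fun q _ => ?_
  field_simp

/-- The average over the phase in the Laplace transform, in terms of Legendre polynomials. -/
theorem average_mftr_laplace (n : ℕ) (hμ : 0 < μ) (hK : 0 ≤ K) (hΔ : 0 ≤ Δ) (hΔ' : Δ ≤ 1)
    {r s A B : ℝ} (hr : 0 < r) (hs : 0 < s)
    (hA : A = (((n + 1 : ℕ) : ℝ) + μ * K) * s + ((n + 1 : ℕ) : ℝ) * r) (hB : B = μ * K * Δ * s) :
    (2 * Real.pi)⁻¹ * ∫ θ in 0..2 * Real.pi, (((n + 1 : ℕ) : ℝ) / (((n + 1 : ℕ) : ℝ) +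
        μ * (K * (1 + Δ * Real.cos θ)) * (s / (r + s)))) ^ (n + 1) =
      (((n + 1 : ℕ) : ℝ) * (r + s)) ^ (n + 1) * (legendreHom n A (A ^ 2 - B ^ 2) /
        (2 ^ n * (A ^ 2 - B ^ 2) ^ n * √(A ^ 2 - B ^ 2))) := by
  have hm : (0 : ℝ) < ((n + 1 : ℕ) : ℝ) := Nat.cast_pos.2 n.succ_pos
  generalize ((n + 1 : ℕ) : ℝ) = m at *
  have hB0 : 0 ≤ B := by rw [hB]; positivity
  -- The inequality is strict even for Δ = 1, because m > 0.
  have hAB : |B| < A := by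
    rw [abs_of_nonneg hB0, hA, hB]
    have : μ * K * Δ * s ≤ μ * K * s := by
      have := mul_le_mul_of_nonneg_left hΔ' (show 0 ≤ μ * K * s by positivity)
      linarith
    have : 0 < m * r := by positivity
    have : 0 < m * s := by positivity
    linarith
  have hpi := Real.pi_pos
  have hcongr : ∀ θ : ℝ, (m / (m + μ * (K * (1 + Δ * Real.cos θ)) * (s / (r + s)))) ^ (n + 1) =
      (m * (r + s)) ^ (n + 1) * ((A + B * Real.cos θ) ^ (n + 1))⁻¹ := by
    intro θ
    have hu := add_mul_cos_pos hAB θ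
    rw [← inv_pow, ← mul_pow]
    congr 1
    have hrs : 0 < r + s := by positivity
    have he : m + μ * (K * (1 + Δ * Real.cos θ)) * (s / (r + s)) =
        (A + B * Real.cos θ) / (r + s) := by
      rw [hA, hB]; field_simp; ring
    rw [he]
    field_simp
  simp only [hcongr]
  rw [intervalIntegral.integral_const_mul, integral_inv_add_mul_cos_pow hAB]
  field_simp

/-- The threshold for s comes from the uniform bounds |b_i| ≤ μ+m and |a_i| ≤ r = (1+K)μ/γ̄, which
bring all four binomial series into their range. -/
theorem laplace_mftrPDF (hm : 0 < m) (hμ : 0 < μ) (hK : 0 ≤ K) (hΔ : 0 ≤ Δ) (hΔ' : Δ ≤ 1)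
    (hγ : 0 < γbar) {s : ℝ} (hs : (μ + m + 1) * ((1 + K) * μ / γbar) < s) :
    IntegrableOn (fun x => Real.exp (-(s * x)) * mftrPDF m μ K Δ γbar x) (Set.Ioi 0) ∧
    ∫ x in Set.Ioi 0, Real.exp (-(s * x)) * mftrPDF m μ K Δ γbar x =
      ((1 + K) * μ / γbar / ((1 + K) * μ / γbar + s)) ^ μ *
        ((2 * Real.pi)⁻¹ * ∫ θ in 0..2 * Real.pi, ((m : ℝ) / (m +
          μ * (K * (1 + Δ * Real.cos θ)) * (s / ((1 + K) * μ / γbar + s)))) ^ m) := by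
  obtain ⟨n, rfl⟩ : ∃ n, m = n + 1 := ⟨m - 1, by omega⟩
  obtain ⟨hS, hS2⟩ := mftrRoot_pos hm hμ hK hΔ hΔ'
  have hm' : (0 : ℝ) < ((n + 1 : ℕ) : ℝ) := Nat.cast_pos.2 hm
  have hmn : ((n + 1 : ℕ) : ℝ) = n + 1 := by push_cast; ring
  have h1Δ : 0 ≤ 1 - Δ := by linarith
  set S := mftrRoot (n + 1) μ K Δ with hSdef
  set M : ℝ := ((n + 1 : ℕ) : ℝ) with hMdef
  have hrpos : 0 < (1 + K) * μ / γbar := by positivity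
  have hspos : 0 < s := lt_of_le_of_lt (by positivity) hs
  rw [average_mftr_laplace n hμ hK hΔ hΔ' hrpos hspos rfl rfl]
  set r := (1 + K) * μ / γbar with hr
  have ha : ∀ {t : ℝ}, 0 ≤ t → (1 + K) * M * μ / ((M + t) * γbar) = r * (M / (M + t)) := by
    intro t ht
    rw [hr]; field_simp
  have habs : ∀ {t : ℝ}, 0 ≤ t → |-(r * (M / (M + t)))| ≤ r := by
    intro t ht
    rw [abs_neg, abs_of_nonneg (by positivity)]
    exact mul_le_of_le_one_right hrpos.le ((div_le_one (by positivity)).2 (by linarith))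
  have hbound : ∀ {b a : ℝ}, |b| ≤ μ + M → |a| ≤ r → (|b| + 1) * |a| < s := by
    intro b a hb ha
    refine lt_of_le_of_lt ?_ hs
    gcongr
  have t₁ : 0 ≤ μ * K := by positivity
  have t₂ : 0 ≤ μ * K * (1 + Δ) := by positivity
  have t₃ : 0 ≤ μ * K * (1 - Δ) := by positivity
  set A := (M + μ * K) * s + M * r with hA
  set B := μ * K * Δ * s with hB
  have hApos : 0 < A := by positivity
  have hABp : A + B = (M + μ * K * (1 + Δ)) * s + M * r := by rw [hA, hB]; ring
  have hABm : A - B = (M + μ * K * (1 - Δ)) * s + M * r := by rw [hA, hB]; ring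
  have hDeq : A ^ 2 - B ^ 2 = (A + B) * (A - B) := by ring
  have hABp0 : 0 < A + B := by rw [hABp]; positivity
  have hABm0 : 0 < A - B := by rw [hABm]; positivity
  have hD : 0 < A ^ 2 - B ^ 2 := by rw [hDeq]; positivity
  -- For the three values of t in use, the numerators are A, A+B and A-B.
  have hone : ∀ {t : ℝ}, 0 ≤ t → 1 - -(r * (M / (M + t))) / s =
      ((M + t) * s + M * r) / ((M + t) * s) := by
    intro t ht
    field_simp
    ring
  have hqb : ∀ q ∈ Finset.range ((n + 1 - 1) / 2 + 1), 2 * q ≤ n := by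
    intro q hq
    rw [Finset.mem_range] at hq
    omega
  have hL := fun q (hq : q ∈ Finset.range ((n + 1 - 1) / 2 + 1)) =>
    laplace_rpow_mul_phi2Four (1 + 2 * (q : ℝ) - M) (M - q - 1 / 2) (M - q - 1 / 2) (μ - M) hμ hspos
      (a₁ := -(r * (M / (M + μ * K)))) (a₂ := -(r * (M / (M + μ * K * (1 + Δ)))))
      (a₃ := -(r * (M / (M + μ * K * (1 - Δ))))) (a₄ := -r)
      (hbound (by
        have : (2 * q : ℝ) ≤ n := by exact_mod_cast hqb q hq
        rw [abs_le]; constructor <;> linarith [(Nat.cast_nonneg q : (0 : ℝ) ≤ q)]) (habs t₁))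
      (hbound (by
        have : (2 * q : ℝ) ≤ n := by exact_mod_cast hqb q hq
        rw [abs_le]; constructor <;> linarith [(Nat.cast_nonneg q : (0 : ℝ) ≤ q)]) (habs t₂))
      (hbound (by
        have : (2 * q : ℝ) ≤ n := by exact_mod_cast hqb q hq
        rw [abs_le]; constructor <;> linarith [(Nat.cast_nonneg q : (0 : ℝ) ≤ q)]) (habs t₃))
      (hbound (by rw [abs_le]; constructor <;> linarith) (by rw [abs_neg, abs_of_pos hrpos]))
  have hexp : ∀ x : ℝ, Real.exp (-(s * x)) * mftrPDF (n + 1) μ K Δ γbar x =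
      (1 + K) ^ μ * μ ^ μ / (2 ^ n * Real.Gamma μ * γbar ^ μ) * (M / S) ^ (n + 1) *
      ∑ q ∈ Finset.range ((n + 1 - 1) / 2 + 1),
        ((-1 : ℝ) ^ q * (legendreCoeff n q : ℝ) * ((M + μ * K) / S) ^ (n - 2 * q)) *
        (Real.exp (-(s * x)) * (x ^ (μ - 1) *
          phi2Four (1 + 2 * (q : ℝ) - M) (M - q - 1 / 2) (M - q - 1 / 2) (μ - M) μ
          (-(r * (M / (M + μ * K))) * x) (-(r * (M / (M + μ * K * (1 + Δ)))) * x)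
          (-(r * (M / (M + μ * K * (1 - Δ)))) * x) (-r * x))) := by
    intro x
    rw [mftrPDF, ← hSdef, ← hMdef, ha t₁, ha t₂, ha t₃, ← hr, mul_left_comm, Finset.mul_sum]
    congr 1
    refine Finset.sum_congr rfl fun q _ => ?_
    simp only [Nat.add_sub_cancel]
    ring
  simp only [hexp]
  refine ⟨(integrable_finsetSum _ fun q hq => (hL q hq).1.const_mul _).const_mul _, ?_⟩
  rw [integral_const_mul, integral_finsetSum _ fun q hq => (hL q hq).1.const_mul _]
  have hterm : ∀ q ∈ Finset.range ((n + 1 - 1) / 2 + 1),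
      ∫ x in Set.Ioi 0, ((-1 : ℝ) ^ q * (legendreCoeff n q : ℝ) * ((M + μ * K) / S) ^ (n - 2 * q)) *
        (Real.exp (-(s * x)) * (x ^ (μ - 1) *
          phi2Four (1 + 2 * (q : ℝ) - M) (M - q - 1 / 2) (M - q - 1 / 2) (μ - M) μ
          (-(r * (M / (M + μ * K))) * x) (-(r * (M / (M + μ * K * (1 + Δ)))) * x)
          (-(r * (M / (M + μ * K * (1 - Δ)))) * x) (-r * x))) =
      Real.Gamma μ * (1 / s) ^ μ * ((r + s) / s) ^ (-(μ - M)) * (S * s) ^ (n + 1) /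
        ((A ^ 2 - B ^ 2) ^ n * √(A ^ 2 - B ^ 2)) *
        ((-1 : ℝ) ^ q * (legendreCoeff n q : ℝ) * A ^ (n - 2 * q) * (A ^ 2 - B ^ 2) ^ q) := by
    intro q hq
    have hq2 := hqb q hq
    obtain ⟨j, hj⟩ := Nat.exists_eq_add_of_le hq2
    rw [integral_const_mul, (hL q hq).2, hone t₁, hone t₂, hone t₃, ← hABp, ← hABm, ← hA,
      show n - 2 * q = j by omega]
    have h4 : 1 - -r / s = (r + s) / s := by field_simp; ring
    have hX : (A + B) / ((M + μ * K * (1 + Δ)) * s) * ((A - B) / ((M + μ * K * (1 - Δ)) * s)) =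
        (A ^ 2 - B ^ 2) / (S * s) ^ 2 := by
      rw [mul_pow S s, hS2, hDeq]; field_simp
    have hjq : (n : ℝ) = 2 * q + j := by exact_mod_cast hj
    have key := legendre_laplace_term (q := q) (j := j) (M := M + μ * K) (by positivity) hS hspos
      hApos hD (X₂ := (A + B) / ((M + μ * K * (1 + Δ)) * s))
      (X₃ := (A - B) / ((M + μ * K * (1 - Δ)) * s)) (by positivity) (by positivity) hX
      (b₁ := 1 + 2 * (q : ℝ) - M) (b₂ := M - q - 1 / 2)
      (by rw [hmn, hjq]; ring) (by rw [hmn, hjq]; push_cast; ring)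
    rw [← hj] at key
    rw [h4]
    calc _ = (-1 : ℝ) ^ q * (legendreCoeff n q : ℝ) * (Real.Gamma μ * (1 / s) ^ μ *
          ((r + s) / s) ^ (-(μ - M))) * (((M + μ * K) / S) ^ j *
          ((A / ((M + μ * K) * s)) ^ (-(1 + 2 * (q : ℝ) - M)) *
          (((A + B) / ((M + μ * K * (1 + Δ)) * s)) ^ (-(M - q - 1 / 2)) *
          ((A - B) / ((M + μ * K * (1 - Δ)) * s)) ^ (-(M - q - 1 / 2))))) := by ring
      _ = _ := by rw [key]; ring
  rw [Finset.sum_congr rfl hterm, ← Finset.mul_sum, Nat.add_sub_cancel, ← legendreHom]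
  have hrs : 0 < r + s := by positivity
  have hΓ := Real.Gamma_pos_of_pos hμ
  have hpow : ((r + s) / s) ^ (-(μ - M)) = ((r + s) / s) ^ (n + 1) / ((r + s) ^ μ / s ^ μ) := by
    rw [neg_sub, Real.rpow_sub (by positivity), hMdef, Real.rpow_natCast,
      Real.div_rpow hrs.le hspos.le]
  have hrμ : (1 + K) ^ μ * μ ^ μ = r ^ μ * γbar ^ μ := by
    rw [← Real.mul_rpow (by positivity) hμ.le, ← Real.mul_rpow hrpos.le hγ.le, hr,
      div_mul_cancel₀ _ hγ.ne']
  rw [hpow, hrμ, Real.div_rpow hrpos.le hrs.le, Real.div_rpow zero_le_one hspos.le, Real.one_rpow]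
  have hrsμ : 0 < (r + s) ^ μ := by positivity
  have hγμ : 0 < γbar ^ μ := by positivity
  have hsμ : 0 < s ^ μ := by positivity
  have hd := Real.sqrt_pos.2 hD
  simp only [div_pow, mul_pow]
  field_simp
  exact mul_comm _ _

theorem hasPDFAndCDF_of_laplace (hm : 0 < m) (hμ : 0 < μ) (hK : 0 ≤ K) (hΔ : 0 ≤ Δ) (hΔ' : Δ ≤ 1)
    (hγ : 0 < γbar) {ν : Measure ℝ} [IsFiniteMeasure ν] (h0 : ∀ᵐ x ∂ν, 0 ≤ x)
    (h : ∀ s : ℝ, 0 < s → ∫ x, Real.exp (-(s * x)) ∂ν =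
      ((1 + K) * μ / γbar / ((1 + K) * μ / γbar + s)) ^ μ *
        ((2 * Real.pi)⁻¹ * ∫ θ in 0..2 * Real.pi, ((m : ℝ) / (m +
          μ * (K * (1 + Δ * Real.cos θ)) * (s / ((1 + K) * μ / γbar + s)))) ^ m)) :
    HasPDFAndCDF ν (mftrPDF m μ K Δ γbar) (mftrCDF m μ K Δ γbar) := by
  -- The summand 1 puts all of s₀, s₀+1, … strictly above the threshold of `laplace_mftrPDF`.
  set s₀ := (μ + m + 1) * ((1 + K) * μ / γbar) + 1 with hs₀
  have hs₀pos : 0 < s₀ := by positivity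
  have hlap := fun n : ℕ => laplace_mftrPDF hm hμ hK hΔ hΔ' hγ (s := s₀ + n)
    (by have : (0 : ℝ) ≤ n := Nat.cast_nonneg n
        linarith)
  have hd := eq_withDensity_of_laplace h0 (continuousOn_mftrPDF (m := m) (K := K) (Δ := Δ)
    (γbar := γbar) hμ) hs₀pos.le (by simpa using (hlap 0).1)
    fun n => by rw [(hlap n).2, h _ (by positivity)]
  exact hasPDFAndCDF_of_withDensity (continuousOn_mftrPDF hμ) hd.1 hd.2
    fun x hx => intervalIntegral_mftrPDF hμ hx

end Density

/-! ### Gamma and Poisson mixtures: the generalized model -/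

/-- Tilting a Gamma density of rate r gives a multiple of the one of rate r+s, which has mass one.
-/
theorem lintegral_exp_neg_gammaMeasure {a r s : ℝ} (ha : 0 < a) (hr : 0 < r) (hs : 0 ≤ s) :
    ∫⁻ x, ENNReal.ofReal (Real.exp (-(s * x))) ∂gammaMeasure a r =
      ENNReal.ofReal ((r / (r + s)) ^ a) := by
  have hrs : 0 < r + s := by positivity
  have hΓ := Real.Gamma_pos_of_pos ha
  have hg : Measurable (gammaPDF a r) := (measurable_gammaPDFReal a r).ennreal_ofReal
  have hg' : Measurable (gammaPDF a (r + s)) := (measurable_gammaPDFReal a (r + s)).ennreal_ofReal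
  rw [gammaMeasure, lintegral_withDensity_eq_lintegral_mul _ hg (by fun_prop)]
  have hpt : ∀ x, (gammaPDF a r * fun x => ENNReal.ofReal (Real.exp (-(s * x)))) x =
      ENNReal.ofReal ((r / (r + s)) ^ a) * gammaPDF a (r + s) x := by
    intro x
    rw [Pi.mul_apply, gammaPDF, gammaPDF,
      ← ENNReal.ofReal_mul (gammaPDFReal_nonneg ha hr x), ← ENNReal.ofReal_mul (by positivity)]
    congr 1
    unfold gammaPDFReal
    split_ifs with hx
    · rw [Real.div_rpow hr.le hrs.le, show -((r + s) * x) = -(r * x) + -(s * x) by ring,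
        Real.exp_add]
      have : 0 < (r + s) ^ a := by positivity
      field_simp
    · simp
  simp only [hpt]
  rw [lintegral_const_mul _ hg', lintegral_gammaPDF_eq_one ha hrs, mul_one]

theorem gammaMeasure_Iio_zero (a r : ℝ) : gammaMeasure a r (Set.Iio 0) = 0 := by
  rw [gammaMeasure, withDensity_apply _ measurableSet_Iio, lintegral_gammaPDF_of_nonpos le_rfl]

theorem lintegral_poissonMeasure (δ : NNReal) (f : ℕ → ENNReal) :
    ∫⁻ j, f j ∂poissonMeasure δ =
      ∑' j, ENNReal.ofReal (Real.exp (-δ) * δ ^ j / (j.factorial : ℝ)) * f j := by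
  simp [poissonMeasure, lintegral_sum_measure, lintegral_smul_measure]

theorem lintegral_kappaMuPowerLaw (μ δ r : ℝ) {f : ℝ → ENNReal} (hf : Measurable f) :
    ∫⁻ x, f x ∂kappaMuPowerLaw μ δ r =
      ∑' j : ℕ, ENNReal.ofReal (Real.exp (-δ.toNNReal) * δ.toNNReal ^ j / (j.factorial : ℝ)) *
        ∫⁻ x, f x ∂gammaMeasure (μ + j) r := by
  rw [kappaMuPowerLaw, Measure.lintegral_bind Measurable.of_discrete.aemeasurable hf.aemeasurable,
    lintegral_poissonMeasure]

theorem kappaMuPowerLaw_apply (μ δ r : ℝ) {t : Set ℝ} (ht : MeasurableSet t) :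
    kappaMuPowerLaw μ δ r t =
      ∑' j : ℕ, ENNReal.ofReal (Real.exp (-δ.toNNReal) * δ.toNNReal ^ j / (j.factorial : ℝ)) *
        gammaMeasure (μ + j) r t := by
  rw [kappaMuPowerLaw, Measure.bind_apply ht Measurable.of_discrete.aemeasurable,
    lintegral_poissonMeasure]

theorem measurable_kappaMuPowerLaw (μ r : ℝ) : Measurable fun δ => kappaMuPowerLaw μ δ r := by
  refine Measure.measurable_of_measurable_coe _ fun t ht => ?_
  simp only [kappaMuPowerLaw_apply _ _ _ ht]
  refine Measurable.tsum fun j => ?_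
  fun_prop

/-- Needed to expand the outer mixture over the phase, which enters only through w = μκ_θ. -/
theorem measurable_bind_kappaMuPowerLaw (m μ r : ℝ) [SFinite (gammaMeasure m m)] :
    Measurable fun w => (gammaMeasure m m).bind fun z => kappaMuPowerLaw μ (z * w) r := by
  refine Measure.measurable_of_measurable_coe _ fun t ht => ?_
  have hz : ∀ w : ℝ, Measurable fun z : ℝ => kappaMuPowerLaw μ (z * w) r := fun w =>
    (measurable_kappaMuPowerLaw μ r).comp (measurable_id.mul_const w)
  simp only [Measure.bind_apply ht (hz _).aemeasurable]
  refine Measurable.lintegral_prod_right' (f := fun p : ℝ × ℝ => kappaMuPowerLaw μ (p.2 * p.1) r t)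
    ?_
  exact ((Measure.measurable_coe ht).comp (measurable_kappaMuPowerLaw μ r)).comp
    (measurable_snd.mul measurable_fst)

/-- With ρ = r/(r+s), the Poisson average of ρ^(μ+j) is ρ^μ exp(-δ(1-ρ)), and 1-ρ = s/(r+s). -/
theorem lintegral_exp_neg_kappaMuPowerLaw {μ δ r s : ℝ} (hμ : 0 < μ) (hδ : 0 ≤ δ) (hr : 0 < r)
    (hs : 0 ≤ s) :
    ∫⁻ x, ENNReal.ofReal (Real.exp (-(s * x))) ∂kappaMuPowerLaw μ δ r =
      ENNReal.ofReal ((r / (r + s)) ^ μ) *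
        ENNReal.ofReal (Real.exp (-(δ * (s / (r + s))))) := by
  have hrs : 0 < r + s := by positivity
  rw [lintegral_kappaMuPowerLaw _ _ _ (by fun_prop)]
  have hterm : ∀ j : ℕ, ENNReal.ofReal
      (Real.exp (-δ.toNNReal) * δ.toNNReal ^ j / (j.factorial : ℝ)) *
        ∫⁻ x, ENNReal.ofReal (Real.exp (-(s * x))) ∂gammaMeasure (μ + j) r =
      ENNReal.ofReal ((r / (r + s)) ^ μ * Real.exp (-δ) *
        ((δ * (r / (r + s))) ^ j / (j.factorial : ℝ))) := by
    intro j
    rw [lintegral_exp_neg_gammaMeasure (by positivity) hr hs, ← ENNReal.ofReal_mul (by positivity),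
      Real.coe_toNNReal _ hδ, Real.rpow_add (by positivity), Real.rpow_natCast, mul_pow]
    congr 1
    ring
  simp only [hterm]
  rw [← ENNReal.ofReal_mul (by positivity), ← ENNReal.ofReal_tsum_of_nonneg
    (fun j => by positivity) ((Real.summable_pow_div_factorial _).mul_left _), tsum_mul_left]
  have hexp := (NormedSpace.expSeries_div_hasSum_exp (δ * (r / (r + s)))).tsum_eq
  rw [← Real.exp_eq_exp_ℝ] at hexp
  rw [hexp, mul_assoc, ← Real.exp_add]
  congr 3
  field_simp
  ring

theorem volume_Ioo_zero_two_pi :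
    (volume (Set.Ioo 0 (2 * Real.pi)))⁻¹ = ENNReal.ofReal (2 * Real.pi)⁻¹ := by
  rw [Real.volume_Ioo, sub_zero, ENNReal.ofReal_inv_of_pos (by positivity)]

theorem isProbabilityMeasure_uniformPhase : IsProbabilityMeasure uniformPhase := by
  refine cond_isProbabilityMeasure_of_finite ?_ ?_
  · simp [Real.pi_pos]
  · rw [Real.volume_Ioo]
    exact ENNReal.ofReal_ne_top

theorem lintegral_uniformPhase {g : ℝ → ℝ} (hg : Continuous g) (hg0 : ∀ θ, 0 ≤ g θ) :
    ∫⁻ θ, ENNReal.ofReal (g θ) ∂uniformPhase =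
      ENNReal.ofReal ((2 * Real.pi)⁻¹ * ∫ θ in 0..2 * Real.pi, g θ) := by
  have hpi : 0 ≤ 2 * Real.pi := by positivity
  rw [uniformPhase, ProbabilityTheory.cond, lintegral_smul_measure, volume_Ioo_zero_two_pi,
    ENNReal.ofReal_mul (by positivity), smul_eq_mul, intervalIntegral.integral_of_le hpi,
    integral_Ioc_eq_integral_Ioo, ofReal_integral_eq_lintegral_ofReal
      ((hg.integrableOn_Icc (a := 0) (b := 2 * Real.pi)).mono_set Set.Ioo_subset_Icc_self)
      (Filter.Eventually.of_forall hg0)]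

theorem one_add_mul_cos_nonneg {Δ : ℝ} (hΔ : 0 ≤ Δ) (hΔ' : Δ ≤ 1) (θ : ℝ) :
    0 ≤ 1 + Δ * Real.cos θ := by
  nlinarith [Real.neg_one_le_cos θ]

section Mixture

variable {m : ℕ} {μ K Δ γbar : ℝ}

/-- The meeting point of the two models: the shadowing is integrated out by the Gamma transform.
Lower integrals make integrability assumptions superfluous. -/
theorem hasPDFAndCDF_of_lintegral_laplace (hm : 0 < m) (hμ : 0 < μ) (hK : 0 ≤ K) (hΔ : 0 ≤ Δ)
    (hΔ' : Δ ≤ 1) (hγ : 0 < γbar) {ν : Measure ℝ} (h0 : ν (Set.Iio 0) = 0)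
    (h : ∀ s : ℝ, 0 ≤ s → ∫⁻ x, ENNReal.ofReal (Real.exp (-(s * x))) ∂ν =
      ENNReal.ofReal (((1 + K) * μ / γbar / ((1 + K) * μ / γbar + s)) ^ μ) *
        ∫⁻ θ, ∫⁻ z, ENNReal.ofReal (Real.exp (-(z * (μ * (K * (1 + Δ * Real.cos θ))) *
          (s / ((1 + K) * μ / γbar + s))))) ∂gammaMeasure m m ∂uniformPhase) :
    HasPDFAndCDF ν (mftrPDF m μ K Δ γbar) (mftrCDF m μ K Δ γbar) := by
  have hm' : (0 : ℝ) < m := Nat.cast_pos.2 hm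
  have hr : 0 < (1 + K) * μ / γbar := by positivity
  set r := (1 + K) * μ / γbar with hrdef
  have hcos := one_add_mul_cos_nonneg hΔ hΔ'
  have hval : ∀ s : ℝ, 0 ≤ s → ∫⁻ x, ENNReal.ofReal (Real.exp (-(s * x))) ∂ν =
      ENNReal.ofReal ((r / (r + s)) ^ μ *
        ((2 * Real.pi)⁻¹ * ∫ θ in 0..2 * Real.pi, ((m : ℝ) / (m +
          μ * (K * (1 + Δ * Real.cos θ)) * (s / (r + s)))) ^ m)) := by
    intro s hs
    have hw : ∀ θ, 0 ≤ μ * (K * (1 + Δ * Real.cos θ)) * (s / (r + s)) := fun θ => by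
      have := hcos θ
      positivity
    have hz : ∀ θ, ∫⁻ z, ENNReal.ofReal (Real.exp (-(z * (μ * (K * (1 + Δ * Real.cos θ))) *
          (s / (r + s))))) ∂gammaMeasure m m =
        ENNReal.ofReal (((m : ℝ) / (m + μ * (K * (1 + Δ * Real.cos θ)) * (s / (r + s)))) ^ m) := by
      intro θ
      rw [← Real.rpow_natCast, ← lintegral_exp_neg_gammaMeasure hm' hm' (hw θ)]
      refine lintegral_congr fun z => ?_
      congr 3
      ring
    rw [h s hs]
    simp only [hz]
    rw [lintegral_uniformPhase, ← ENNReal.ofReal_mul (by positivity)]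
    · refine (Continuous.div (by fun_prop) (by fun_prop) fun θ => ?_).pow m
      have := hw θ
      positivity
    · intro θ
      have := hw θ
      positivity
  -- The transform at s = 0 is the total mass.
  have hfin : IsFiniteMeasure ν := by
    refine ⟨?_⟩
    have := hval 0 le_rfl
    simp only [zero_mul, neg_zero, Real.exp_zero, ENNReal.ofReal_one, lintegral_one] at this
    rw [this]
    exact ENNReal.ofReal_lt_top
  refine hasPDFAndCDF_of_laplace hm hμ hK hΔ hΔ' hγ ?_ fun s hs => ?_
  · rw [ae_iff]
    simp only [not_le]
    exact h0
  · rw [integral_eq_lintegral_of_nonneg_ae (Filter.Eventually.of_forall fun x => (Real.exp_pos _).le)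
      (by fun_prop), hval s hs.le, ENNReal.toReal_ofReal]
    have h_int : 0 ≤ ∫ θ in 0..2 * Real.pi, ((m : ℝ) / (m +
          μ * (K * (1 + Δ * Real.cos θ)) * (s / (r + s)))) ^ m :=
      intervalIntegral.integral_nonneg (by positivity) fun θ _ => by
        have := hcos θ
        positivity
    positivity

/-- The conditional mean is proportional to 1+κ_θ, so this factor cancels and the Gamma rate no
longer depends on θ. -/
theorem mftrLaw_eq (hK : 0 ≤ K) (hΔ : 0 ≤ Δ) (hΔ' : Δ ≤ 1) (hγ : 0 < γbar) :
    mftrLaw m μ K Δ γbar = uniformPhase.bind fun θ => (gammaMeasure m m).bind fun z =>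
      kappaMuPowerLaw μ (z * (μ * (K * (1 + Δ * Real.cos θ)))) ((1 + K) * μ / γbar) := by
  rw [mftrLaw]
  congr 1
  ext1 θ
  rw [kappaMuShadowedLaw]
  have h := mul_nonneg hK (one_add_mul_cos_nonneg hΔ hΔ' θ)
  have hr : μ * (1 + K * (1 + Δ * Real.cos θ)) / (γbar * (1 + K * (1 + Δ * Real.cos θ)) / (1 + K)) =
      (1 + K) * μ / γbar := by
    field_simp
  rw [hr]

theorem hasPDFAndCDF_mftrLaw (hm : 0 < m) (hμ : 0 < μ) (hK : 0 ≤ K) (hΔ : 0 ≤ Δ) (hΔ' : Δ ≤ 1)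
    (hγ : 0 < γbar) :
    HasPDFAndCDF (mftrLaw m μ K Δ γbar) (mftrPDF m μ K Δ γbar) (mftrCDF m μ K Δ γbar) := by
  have hm' : (0 : ℝ) < m := Nat.cast_pos.2 hm
  have hr : 0 < (1 + K) * μ / γbar := by positivity
  have := isProbabilityMeasure_gammaMeasure hm' hm'
  rw [mftrLaw_eq hK hΔ hΔ' hγ]
  set r := (1 + K) * μ / γbar with hrdef
  have hcos := one_add_mul_cos_nonneg hΔ hΔ'
  have hmθ : Measurable fun θ => (gammaMeasure m m).bind fun z =>
      kappaMuPowerLaw μ (z * (μ * (K * (1 + Δ * Real.cos θ)))) r :=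
    (measurable_bind_kappaMuPowerLaw m μ r).comp
      (g := fun w => (gammaMeasure m m).bind fun z => kappaMuPowerLaw μ (z * w) r)
      (f := fun θ => μ * (K * (1 + Δ * Real.cos θ))) (by fun_prop)
  have hmz : ∀ w : ℝ, Measurable fun z : ℝ => kappaMuPowerLaw μ (z * w) r := fun w =>
    (measurable_kappaMuPowerLaw μ r).comp (measurable_id.mul_const w)
  refine hasPDFAndCDF_of_lintegral_laplace hm hμ hK hΔ hΔ' hγ ?_ fun s hs => ?_
  · rw [Measure.bind_apply measurableSet_Iio hmθ.aemeasurable]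
    simp only [Measure.bind_apply measurableSet_Iio (hmz _).aemeasurable,
      kappaMuPowerLaw_apply _ _ _ measurableSet_Iio, gammaMeasure_Iio_zero, mul_zero, tsum_zero,
      lintegral_zero]
  · rw [Measure.lintegral_bind hmθ.aemeasurable (by fun_prop), ← lintegral_const_mul']
    · refine lintegral_congr fun θ => ?_
      rw [Measure.lintegral_bind (hmz _).aemeasurable (by fun_prop), ← lintegral_const_mul']
      · refine lintegral_congr_ae ?_
        have hz : ∀ᵐ z ∂gammaMeasure (m : ℝ) m, 0 ≤ z := by
          rw [ae_iff]
          simp only [not_le]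
          exact gammaMeasure_Iio_zero (m : ℝ) m
        filter_upwards [hz] with z hz
        have := hcos θ
        rw [lintegral_exp_neg_kappaMuPowerLaw hμ (by positivity) hr hs]
      · simp
    · simp

end Mixture

/-! ### Gaussian and Gamma integrals for the physical model -/

/-- Completing the square: the integrand is a multiple of the Gaussian density with variance
v/(1+2vt) and mean -2tav/(1+2vt). -/
theorem lintegral_exp_neg_sq_gaussianReal {v : NNReal} (hv : v ≠ 0) {t : ℝ} (ht : 0 ≤ t) (a : ℝ) :
    ∫⁻ x, ENNReal.ofReal (Real.exp (-(t * (a + x) ^ 2))) ∂gaussianReal 0 v =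
      ENNReal.ofReal ((√(1 + 2 * v * t))⁻¹ * Real.exp (-(t * a ^ 2 / (1 + 2 * v * t)))) := by
  have hv0 : (0 : ℝ) < v := NNReal.coe_pos.2 (pos_iff_ne_zero.2 hv)
  have hw : (0 : ℝ) < 1 + 2 * v * t := by positivity
  set w : ℝ := 1 + 2 * v * t with hwdef
  obtain ⟨v', hv'⟩ : ∃ v' : NNReal, (v' : ℝ) = v / w := ⟨⟨v / w, by positivity⟩, rfl⟩
  have hv'0 : v' ≠ 0 := by
    rw [← NNReal.coe_ne_zero, hv']; positivity
  rw [gaussianReal_of_var_ne_zero _ hv, lintegral_withDensity_eq_lintegral_mul _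
    (measurable_gaussianPDF 0 v) (by fun_prop)]
  have hpt : ∀ x, (gaussianPDF 0 v * fun x => ENNReal.ofReal (Real.exp (-(t * (a + x) ^ 2)))) x =
      ENNReal.ofReal ((√w)⁻¹ * Real.exp (-(t * a ^ 2 / w))) *
        gaussianPDF (-(2 * t * a * v / w)) v' x := by
    intro x
    rw [Pi.mul_apply, gaussianPDF, gaussianPDF, ← ENNReal.ofReal_mul (gaussianPDFReal_nonneg _ _ _),
      ← ENNReal.ofReal_mul (by positivity)]
    congr 1
    rw [gaussianPDFReal, gaussianPDFReal, hv', ← mul_div_assoc, Real.sqrt_div (by positivity),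
      inv_div, mul_assoc, ← Real.exp_add, mul_mul_mul_comm, ← Real.exp_add]
    have hsw : √w ≠ 0 := (Real.sqrt_pos.2 hw).ne'
    congr 1
    · field_simp
    · congr 1
      field_simp
      rw [hwdef]
      ring
  simp only [hpt]
  rw [lintegral_const_mul _ (measurable_gaussianPDF _ _), lintegral_gaussianPDF_eq_one _ hv'0,
    mul_one]

theorem lintegral_sq_gaussianReal (v : NNReal) (a : ℝ) :
    ∫⁻ x, ENNReal.ofReal ((a + x) ^ 2) ∂gaussianReal 0 v = ENNReal.ofReal (a ^ 2 + v) := by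
  have hmap := gaussianReal_map_const_add (μ := 0) (v := v) a
  rw [zero_add] at hmap
  have h₁ : ∫⁻ x, ENNReal.ofReal ((a + x) ^ 2) ∂gaussianReal 0 v =
      ∫⁻ x, ENNReal.ofReal (x ^ 2) ∂gaussianReal a v := by
    rw [← hmap, lintegral_map (by fun_prop) (by fun_prop)]
  have hL : MemLp id 2 (gaussianReal a v) := memLp_id_gaussianReal 2
  rw [h₁, ← ofReal_integral_eq_lintegral_ofReal (f := fun x => x ^ 2) hL.integrable_sq
    (Filter.Eventually.of_forall fun x => sq_nonneg x)]
  congr 1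
  have hvar := variance_eq_sub hL
  rw [variance_id_gaussianReal] at hvar
  simp only [Pi.pow_apply, id, integral_id_gaussianReal] at hvar ⊢
  linarith

/-- Off 0, z times the Gamma density of shape a and rate a is the density of shape a+1 and the same
rate. -/
theorem lintegral_id_gammaMeasure {a : ℝ} (ha : 0 < a) :
    ∫⁻ z, ENNReal.ofReal z ∂gammaMeasure a a = 1 := by
  have hg : Measurable (gammaPDF a a) := (measurable_gammaPDFReal a a).ennreal_ofReal
  rw [gammaMeasure, lintegral_withDensity_eq_lintegral_mul _ hg (by fun_prop),
    ← lintegral_gammaPDF_eq_one (a := a + 1) (r := a) (by positivity) ha]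
  refine lintegral_congr_ae ?_
  have hne : ∀ᵐ x : ℝ, x ≠ 0 := by simp [ae_iff]
  filter_upwards [hne] with x hx0
  rw [Pi.mul_apply, gammaPDF, gammaPDF, ← ENNReal.ofReal_mul (gammaPDFReal_nonneg ha ha x)]
  congr 1
  unfold gammaPDFReal
  split_ifs with hx
  · have hxp : 0 < x := lt_of_le_of_ne hx (Ne.symm hx0)
    have hΓ := Real.Gamma_pos_of_pos ha
    rw [Real.Gamma_add_one ha.ne', Real.rpow_add_one ha.ne', show a + 1 - 1 = a - 1 + 1 by ring,
      Real.rpow_add_one hx0]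
    field_simp
  · simp

/-! ### Independence and integration over frozen variables -/

section Independence

variable {Ω : Type*} [MeasurableSpace Ω] {P : Measure Ω}

theorem indepFun_comp_of_disjoint_range {ι κ τ : Type*} [Finite κ] [Finite τ] {f : ι → Ω → ℝ}
    (h : iIndepFun f P) (hf : ∀ i, AEMeasurable (f i) P) (g : κ → ι) (e : τ → ι)
    (hd : ∀ a b, g a ≠ e b) :
    IndepFun (fun ω a => f (g a) ω) (fun ω b => f (e b) ω) P := by
  classical
  have := Fintype.ofFinite κ
  have := Fintype.ofFinite τ
  have hST : Disjoint (Finset.univ.image g) (Finset.univ.image e) := by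
    rw [Finset.disjoint_left]
    intro i hi hi'
    obtain ⟨a, _, rfl⟩ := Finset.mem_image.1 hi
    obtain ⟨b, _, hb⟩ := Finset.mem_image.1 hi'
    exact hd a b hb.symm
  have hi := h.indepFun_finset₀ _ _ hST hf
  exact hi.comp
    (φ := fun y a => y ⟨g a, Finset.mem_image_of_mem g (Finset.mem_univ a)⟩)
    (ψ := fun y b => y ⟨e b, Finset.mem_image_of_mem e (Finset.mem_univ b)⟩)
    (by fun_prop) (by fun_prop)

theorem lintegral_comp_prodMk_of_indepFun [IsFiniteMeasure P] {α β : Type*} [MeasurableSpace α]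
    [MeasurableSpace β] {X : Ω → α} {Y : Ω → β} {ρ : Measure β} (hX : AEMeasurable X P)
    (hY : HasLaw Y ρ P) (h : IndepFun X Y P) {f : α × β → ENNReal} (hf : Measurable f) :
    ∫⁻ ω, f (X ω, Y ω) ∂P = ∫⁻ ω, ∫⁻ y, f (X ω, y) ∂ρ ∂P := by
  have hYm := hY.aemeasurable
  have hfin : IsFiniteMeasure ρ := hY.map_eq ▸ inferInstance
  rw [← lintegral_map' (f := f) (g := fun ω => (X ω, Y ω)) hf.aemeasurable (hX.prodMk hYm),
    (indepFun_iff_map_prod_eq_prod_map_map hX hYm).1 h, hY.map_eq, lintegral_prod _ hf.aemeasurable,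
    lintegral_map' hf.lintegral_prod_right'.aemeasurable hX]

theorem hasLaw_pi_of_iIndepFun [IsProbabilityMeasure P] {κ : Type*} [Fintype κ] {X : κ → Ω → ℝ}
    {ρ : κ → Measure ℝ} (h : iIndepFun X P) (hX : ∀ k, HasLaw (X k) (ρ k) P) :
    HasLaw (fun ω k => X k ω) (Measure.pi ρ) P := by
  refine ⟨aemeasurable_pi_lambda _ fun k => (hX k).aemeasurable, ?_⟩
  rw [(iIndepFun_iff_map_fun_eq_pi_map fun k => (hX k).aemeasurable).1 h]
  congr 1
  ext1 k
  exact (hX k).map_eq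

end Independence

theorem lintegral_pi_prod {κ : Type*} [Fintype κ] {ρ : κ → Measure ℝ}
    [∀ k, IsProbabilityMeasure (ρ k)] {F : κ → ℝ → ENNReal} (hF : ∀ k, Measurable (F k)) :
    ∫⁻ x, ∏ k, F k (x k) ∂Measure.pi ρ = ∏ k, ∫⁻ x, F k x ∂ρ k := by
  rw [lintegral_prod_eq_prod_lintegral_of_indepFun Finset.univ (fun k (x : κ → ℝ) => F k (x k))
    (iIndepFun_pi fun k => (hF k).aemeasurable) fun k => (hF k).comp (measurable_pi_apply k)]
  refine Finset.prod_congr rfl fun k _ => ?_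
  rw [← (measurePreserving_eval ρ k).lintegral_comp (hF k)]

/-- Intervals of length 2π are fundamental domains for the periods of the cosine, so a shift of the
phase is invisible. -/
theorem lintegral_uniformPhase_sub {J : ℝ → ENNReal} (φ : ℝ) :
    ∫⁻ θ, J (Real.cos (θ - φ)) ∂uniformPhase = ∫⁻ θ, J (Real.cos θ) ∂uniformPhase := by
  have h2 : 0 < 2 * Real.pi := by positivity
  have hp : ∀ ψ : ℝ, ∫⁻ θ in Set.Ioo 0 (2 * Real.pi), J (Real.cos (θ - ψ)) =
      ∫⁻ θ in Set.Ioc (0 - ψ) (0 - ψ + 2 * Real.pi), J (Real.cos θ) := by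
    intro ψ
    rw [setLIntegral_congr Ioo_ae_eq_Ioc]
    have := (measurePreserving_sub_right volume ψ).setLIntegral_comp_preimage_emb
      (measurableEmbedding_subRight ψ) (fun θ => J (Real.cos θ))
      (Set.Ioc (0 - ψ) (0 - ψ + 2 * Real.pi))
    rw [← this]
    congr 2
    ext θ
    simp only [Set.mem_preimage, Set.mem_Ioc]
    constructor <;> rintro ⟨h₁, h₂⟩ <;> constructor <;> linarith
  have hshift := (isAddFundamentalDomain_Ioc h2 (0 - φ)).setLIntegral_eq
    (isAddFundamentalDomain_Ioc h2 (0 - 0)) (fun θ => J (Real.cos θ)) (by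
      rintro ⟨g, hg⟩ x
      obtain ⟨k, rfl⟩ := AddSubgroup.mem_zmultiples_iff.1 hg
      simp only [AddSubgroup.mk_vadd, vadd_eq_add, zsmul_eq_mul]
      rw [add_comm, Real.cos_add_int_mul_two_pi])
  have h0 := hp 0
  simp only [sub_zero] at h0 hshift
  simp only [uniformPhase, ProbabilityTheory.cond, lintegral_smul_measure]
  rw [hp φ, hshift, h0]

/-! ### The physical model: conditioning on the specular components -/

namespace MFTRSource

/-- The diffuse components: real parts, then imaginary parts. -/
def gauss {n : ℕ} : Fin (n + 1) ⊕ Fin (n + 1) → MFTRSource n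
  | .inl i => .re i
  | .inr i => .im i

/-- The shadowing, the two phases of the first cluster, and the phases of the other clusters. -/
def specular {n : ℕ} : Fin 3 ⊕ Fin n → MFTRSource n
  | .inl 0 => .shadow
  | .inl 1 => .phase₁
  | .inl 2 => .phase₂
  | .inr i => .phase i

theorem gauss_injective {n : ℕ} : Function.Injective (gauss (n := n)) := by
  rintro (i | i) (j | j) h <;> simp_all [gauss]

theorem gauss_ne_specular {n : ℕ} (a : Fin (n + 1) ⊕ Fin (n + 1)) (b : Fin 3 ⊕ Fin n) :
    gauss a ≠ specular b := by
  rcases a with i | i <;> rcases b with j | j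
  all_goals first | (fin_cases j <;> simp [gauss, specular]) | simp [gauss, specular]

end MFTRSource

open MFTRSource

section Specular

variable {n : ℕ} (V₁ V₂ : ℝ) (U : Fin n → ℝ)

/-- Real and imaginary parts of the specular components, as a function of the shadowing and of the
phases. -/
noncomputable def specularMean (y : Fin 3 ⊕ Fin n → ℝ) : Fin (n + 1) ⊕ Fin (n + 1) → ℝ
  | .inl i => √(y (.inl 0)) * (Fin.cons (V₁ * Real.cos (y (.inl 1)) + V₂ * Real.cos (y (.inl 2)))
      (fun i => U i * Real.cos (y (.inr i))) : Fin (n + 1) → ℝ) i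
  | .inr i => √(y (.inl 0)) * (Fin.cons (V₁ * Real.sin (y (.inl 1)) + V₂ * Real.sin (y (.inl 2)))
      (fun i => U i * Real.sin (y (.inr i))) : Fin (n + 1) → ℝ) i

theorem measurable_specularMean (k : Fin (n + 1) ⊕ Fin (n + 1)) :
    Measurable fun y => specularMean V₁ V₂ U y k := by
  rcases k with i | i <;> refine Fin.cases ?_ (fun i => ?_) i <;>
    simp only [specularMean, Fin.cons_zero, Fin.cons_succ] <;> fun_prop

/-- Only the first cluster has a cross term; the phases of the other clusters disappear. The square
of the root is kept because y is arbitrary here, while the shadowing is nonnegative only almost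
surely. -/
theorem sum_specularMean_sq (y : Fin 3 ⊕ Fin n → ℝ) :
    ∑ k, specularMean V₁ V₂ U y k ^ 2 = √(y (.inl 0)) ^ 2 *
      (V₁ ^ 2 + V₂ ^ 2 + ∑ i, U i ^ 2 +
        2 * V₁ * V₂ * Real.cos (y (.inl 1) - y (.inl 2))) := by
  rw [Fintype.sum_sum_type, Fin.sum_univ_succ, Fin.sum_univ_succ]
  simp only [specularMean, Fin.cons_zero, Fin.cons_succ, Real.cos_sub]
  have hU : ∑ i, (√(y (.inl 0)) * (U i * Real.cos (y (.inr i)))) ^ 2 +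
      ∑ i, (√(y (.inl 0)) * (U i * Real.sin (y (.inr i)))) ^ 2 =
      √(y (.inl 0)) ^ 2 * ∑ i, U i ^ 2 := by
    rw [← Finset.sum_add_distrib, Finset.mul_sum]
    refine Finset.sum_congr rfl fun i _ => ?_
    linear_combination √(y (.inl 0)) ^ 2 * U i ^ 2 * Real.sin_sq_add_cos_sq (y (.inr i))
  linear_combination hU +
    √(y (.inl 0)) ^ 2 * V₁ ^ 2 * Real.sin_sq_add_cos_sq (y (.inl 1)) +
    √(y (.inl 0)) ^ 2 * V₂ ^ 2 * Real.sin_sq_add_cos_sq (y (.inl 2))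

theorem sq_norm_specular_add (c a₁ φ₁ a₂ φ₂ x y : ℝ) :
    ‖(c : ℂ) * ((a₁ : ℂ) * Complex.exp (Complex.I * (φ₁ : ℂ)) +
        (a₂ : ℂ) * Complex.exp (Complex.I * (φ₂ : ℂ))) + ((x : ℂ) + Complex.I * (y : ℂ))‖ ^ 2 =
      (c * (a₁ * Real.cos φ₁ + a₂ * Real.cos φ₂) + x) ^ 2 +
        (c * (a₁ * Real.sin φ₁ + a₂ * Real.sin φ₂) + y) ^ 2 := by
  rw [Complex.sq_norm, Complex.normSq_apply, mul_comm Complex.I (φ₁ : ℂ),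
    mul_comm Complex.I (φ₂ : ℂ), Complex.exp_mul_I, Complex.exp_mul_I, ← Complex.ofReal_cos,
    ← Complex.ofReal_cos, ← Complex.ofReal_sin, ← Complex.ofReal_sin]
  generalize Real.cos φ₁ = c₁
  generalize Real.cos φ₂ = c₂
  generalize Real.sin φ₁ = s₁
  generalize Real.sin φ₂ = s₂
  simp
  ring

theorem mftrPower_eq_sum {Ω : Type*} (ξ : MFTRSource n → Ω → ℝ) (ω : Ω) :
    mftrPower V₁ V₂ U ξ ω =
      ∑ k, (specularMean V₁ V₂ U (fun b => ξ (specular b) ω) k + ξ (gauss k) ω) ^ 2 := by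
  rw [mftrPower, sq_norm_specular_add, Fintype.sum_sum_type, Fin.sum_univ_succ, Fin.sum_univ_succ]
  have h : ∀ i : Fin n, ‖(√(ξ .shadow ω) : ℂ) *
      ((U i : ℂ) * Complex.exp (Complex.I * (ξ (.phase i) ω : ℂ))) +
      ((ξ (.re i.succ) ω : ℂ) + Complex.I * (ξ (.im i.succ) ω : ℂ))‖ ^ 2 =
      (√(ξ .shadow ω) * (U i * Real.cos (ξ (.phase i) ω)) + ξ (.re i.succ) ω) ^ 2 +
        (√(ξ .shadow ω) * (U i * Real.sin (ξ (.phase i) ω)) + ξ (.im i.succ) ω) ^ 2 := by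
    intro i
    -- A cluster with one wave is one with two waves, the second of amplitude 0.
    simpa using sq_norm_specular_add (√(ξ .shadow ω)) (U i) (ξ (.phase i) ω) 0 0
      (ξ (.re i.succ) ω) (ξ (.im i.succ) ω)
  simp only [h, specularMean, gauss, specular, Fin.cons_zero, Fin.cons_succ,
    Finset.sum_add_distrib]
  ring

end Specular

section Model

variable {Ω : Type*} [MeasurableSpace Ω] {P : Measure Ω} {n : ℕ} {m σ : ℝ}
  {ξ : MFTRSource n → Ω → ℝ}

theorem IsMFTRModel.aemeasurable (h : IsMFTRModel P n m σ ξ) (i : MFTRSource n) :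
    AEMeasurable (ξ i) P := by
  cases i with
  | shadow => exact h.law_shadow.aemeasurable
  | phase₁ => exact h.law_phase₁.aemeasurable
  | phase₂ => exact h.law_phase₂.aemeasurable
  | phase i => exact (h.law_phase i).aemeasurable
  | re i => exact (h.law_re i).aemeasurable
  | im i => exact (h.law_im i).aemeasurable

/-- Integration over the diffuse components, given the specular ones. -/
theorem IsMFTRModel.lintegral_gauss [IsProbabilityMeasure P] (h : IsMFTRModel P n m σ ξ)
    {f : (Fin 3 ⊕ Fin n → ℝ) × (Fin (n + 1) ⊕ Fin (n + 1) → ℝ) → ENNReal} (hf : Measurable f) :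
    ∫⁻ ω, f (fun b => ξ (specular b) ω, fun k => ξ (gauss k) ω) ∂P =
      ∫⁻ ω, ∫⁻ g, f (fun b => ξ (specular b) ω, g)
        ∂Measure.pi (fun _ => gaussianReal 0 (σ ^ 2).toNNReal) ∂P := by
  refine lintegral_comp_prodMk_of_indepFun (X := fun ω b => ξ (specular b) ω)
    (Y := fun ω k => ξ (gauss k) ω) (aemeasurable_pi_lambda _ fun b => h.aemeasurable _)
    (hasLaw_pi_of_iIndepFun (h.indep.precomp gauss_injective) ?_)
    (indepFun_comp_of_disjoint_range h.indep h.aemeasurable _ _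
      fun b a => (gauss_ne_specular a b).symm) hf
  rintro (i | i)
  · exact h.law_re i
  · exact h.law_im i

/-- Integration over the shadowing and over the phase difference. -/
theorem IsMFTRModel.lintegral_shadow_cos [IsProbabilityMeasure P] (h : IsMFTRModel P n m σ ξ)
    {H : ℝ × ℝ → ENNReal} (hH : Measurable H) :
    ∫⁻ ω, H (ξ .shadow ω, Real.cos (ξ .phase₁ ω - ξ .phase₂ ω)) ∂P =
      ∫⁻ θ, ∫⁻ z, H (z, Real.cos θ) ∂gammaMeasure m m ∂uniformPhase := by
  have hsf : IsFiniteMeasure (gammaMeasure m m) := h.law_shadow.map_eq ▸ inferInstance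
  have hpr := isProbabilityMeasure_uniformPhase
  have h₁ := lintegral_comp_prodMk_of_indepFun
    (X := fun ω => (ξ .phase₁ ω, ξ .phase₂ ω)) (Y := ξ .shadow)
    ((h.aemeasurable _).prodMk (h.aemeasurable _)) h.law_shadow
    (h.indep.indepFun_prodMk₀ h.aemeasurable _ _ _ (by simp) (by simp))
    (f := fun p => H (p.2, Real.cos (p.1.1 - p.1.2))) (by fun_prop)
  have hJ : Measurable fun c => ∫⁻ z, H (z, c) ∂gammaMeasure m m :=
    Measurable.lintegral_prod_left' hH
  have h₂ := lintegral_comp_prodMk_of_indepFun (X := ξ .phase₂) (Y := ξ .phase₁)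
    (h.aemeasurable _) h.law_phase₁ (h.indep.indepFun (by simp))
    (f := fun p => ∫⁻ z, H (z, Real.cos (p.2 - p.1)) ∂gammaMeasure m m)
    (hJ.comp (by fun_prop))
  rw [h₁, h₂]
  -- With φ₂ frozen, shifting φ₁ removes φ₂ altogether, leaving a constant integrated over a
  -- probability measure.
  simp only [lintegral_uniformPhase_sub (J := fun c => ∫⁻ z, H (z, c) ∂gammaMeasure m m)]
  simp

/-- Each of the 2(n+1) real Gaussians contributes (1+2σ²t)^(-1/2), and the exponents add up to the
total specular power. -/
theorem IsMFTRModel.lintegral_exp_neg_mftrPower [IsProbabilityMeasure P]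
    (h : IsMFTRModel P n m σ ξ) (hσ : 0 < σ) (V₁ V₂ : ℝ) (U : Fin n → ℝ) {t : ℝ} (ht : 0 ≤ t) :
    ∫⁻ ω, ENNReal.ofReal (Real.exp (-(t * mftrPower V₁ V₂ U ξ ω))) ∂P =
      ENNReal.ofReal (((1 + 2 * σ ^ 2 * t) ^ (n + 1))⁻¹) *
      ∫⁻ θ, ∫⁻ z, ENNReal.ofReal (Real.exp (-(t * (√z ^ 2 * (V₁ ^ 2 + V₂ ^ 2 + ∑ i, U i ^ 2 +
        2 * V₁ * V₂ * Real.cos θ)) / (1 + 2 * σ ^ 2 * t)))) ∂gammaMeasure m m ∂uniformPhase := by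
  have hv : ((σ ^ 2).toNNReal : ℝ) = σ ^ 2 := Real.coe_toNNReal _ (sq_nonneg σ)
  have hv0 : (σ ^ 2).toNNReal ≠ 0 := by
    rw [← NNReal.coe_ne_zero, hv]; positivity
  have hmean := measurable_specularMean V₁ V₂ U
  have hw : 0 < 1 + 2 * σ ^ 2 * t := by positivity
  simp only [mftrPower_eq_sum]
  rw [h.lintegral_gauss (f := fun p => ENNReal.ofReal
    (Real.exp (-(t * ∑ k, (specularMean V₁ V₂ U p.1 k + p.2 k) ^ 2)))) (by
      have : ∀ k, Measurable fun p : (Fin 3 ⊕ Fin n → ℝ) × (Fin (n + 1) ⊕ Fin (n + 1) → ℝ) =>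
        specularMean V₁ V₂ U p.1 k := fun k => (hmean k).comp measurable_fst
      fun_prop)]
  have hin : ∀ y : Fin 3 ⊕ Fin n → ℝ, ∫⁻ g, ENNReal.ofReal
      (Real.exp (-(t * ∑ k, (specularMean V₁ V₂ U y k + g k) ^ 2)))
        ∂Measure.pi (fun _ => gaussianReal 0 (σ ^ 2).toNNReal) =
      ENNReal.ofReal (((1 + 2 * σ ^ 2 * t) ^ (n + 1))⁻¹) *
        ENNReal.ofReal (Real.exp (-(t * (√(y (.inl 0)) ^ 2 * (V₁ ^ 2 + V₂ ^ 2 + ∑ i, U i ^ 2 +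
        2 * V₁ * V₂ * Real.cos (y (.inl 1) - y (.inl 2)))) / (1 + 2 * σ ^ 2 * t)))) := by
    intro y
    have hprod : ∀ g : Fin (n + 1) ⊕ Fin (n + 1) → ℝ, ENNReal.ofReal
        (Real.exp (-(t * ∑ k, (specularMean V₁ V₂ U y k + g k) ^ 2))) =
        ∏ k, ENNReal.ofReal (Real.exp (-(t * (specularMean V₁ V₂ U y k + g k) ^ 2))) := by
      intro g
      rw [← ENNReal.ofReal_prod_of_nonneg fun k _ => (Real.exp_pos _).le, ← Real.exp_sum,
        Finset.mul_sum, Finset.sum_neg_distrib]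
    simp only [hprod]
    rw [lintegral_pi_prod (F := fun k x => ENNReal.ofReal
      (Real.exp (-(t * (specularMean V₁ V₂ U y k + x) ^ 2)))) fun k => by fun_prop]
    simp only [lintegral_exp_neg_sq_gaussianReal hv0 ht, hv]
    rw [← ENNReal.ofReal_prod_of_nonneg fun k _ => by positivity, ← ENNReal.ofReal_mul
      (by positivity), Finset.prod_mul_distrib, ← Real.exp_sum, Finset.sum_neg_distrib,
      ← Finset.sum_div, ← Finset.mul_sum, sum_specularMean_sq]
    congr 2
    rw [Finset.prod_const, Finset.card_univ, Fintype.card_sum, Fintype.card_fin, inv_pow,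
      ← two_mul, pow_mul, Real.sq_sqrt hw.le]
  simp only [hin]
  rw [lintegral_const_mul' _ _ ENNReal.ofReal_ne_top]
  congr 1
  exact h.lintegral_shadow_cos (H := fun p => ENNReal.ofReal (Real.exp (-(t * (√p.1 ^ 2 *
    (V₁ ^ 2 + V₂ ^ 2 + ∑ i, U i ^ 2 + 2 * V₁ * V₂ * p.2)) / (1 + 2 * σ ^ 2 * t)))))
    (by fun_prop)

/-- Each Gaussian adds σ², the shadowing has mean one, and the cosine averages to zero. This is what
expresses the mean SNR by the physical constants. -/
theorem IsMFTRModel.lintegral_mftrPower [IsProbabilityMeasure P]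
    (h : IsMFTRModel P n m σ ξ) (hm : 0 < m) {V₁ V₂ : ℝ} (U : Fin n → ℝ) :
    ∫⁻ ω, ENNReal.ofReal (mftrPower V₁ V₂ U ξ ω) ∂P =
      ENNReal.ofReal (V₁ ^ 2 + V₂ ^ 2 + ∑ i, U i ^ 2 + 2 * σ ^ 2 * (n + 1)) := by
  have hv : ((σ ^ 2).toNNReal : ℝ) = σ ^ 2 := Real.coe_toNNReal _ (sq_nonneg σ)
  have hmean := measurable_specularMean V₁ V₂ U
  have hc : ∀ θ, 0 ≤ V₁ ^ 2 + V₂ ^ 2 + ∑ i, U i ^ 2 + 2 * V₁ * V₂ * Real.cos θ := by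
    intro θ
    have h1 : 0 ≤ ∑ i, U i ^ 2 := Finset.sum_nonneg fun i _ => sq_nonneg _
    nlinarith [sq_nonneg (V₁ + V₂ * Real.cos θ), Real.sin_sq_add_cos_sq θ,
      sq_nonneg (V₂ * Real.sin θ)]
  simp only [mftrPower_eq_sum]
  rw [h.lintegral_gauss (f := fun p => ENNReal.ofReal
    (∑ k, (specularMean V₁ V₂ U p.1 k + p.2 k) ^ 2)) (by
      have : ∀ k, Measurable fun p : (Fin 3 ⊕ Fin n → ℝ) × (Fin (n + 1) ⊕ Fin (n + 1) → ℝ) =>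
        specularMean V₁ V₂ U p.1 k := fun k => (hmean k).comp measurable_fst
      fun_prop)]
  have hin : ∀ y : Fin 3 ⊕ Fin n → ℝ, ∫⁻ g, ENNReal.ofReal
      (∑ k, (specularMean V₁ V₂ U y k + g k) ^ 2)
        ∂Measure.pi (fun _ => gaussianReal 0 (σ ^ 2).toNNReal) =
      ENNReal.ofReal (√(y (.inl 0)) ^ 2 * (V₁ ^ 2 + V₂ ^ 2 + ∑ i, U i ^ 2 +
        2 * V₁ * V₂ * Real.cos (y (.inl 1) - y (.inl 2))) + 2 * σ ^ 2 * (n + 1)) := by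
    intro y
    simp only [ENNReal.ofReal_sum_of_nonneg fun k _ => sq_nonneg _]
    rw [lintegral_finsetSum _ fun k _ => by fun_prop]
    have hk : ∀ k, ∫⁻ g : Fin (n + 1) ⊕ Fin (n + 1) → ℝ, ENNReal.ofReal
        ((specularMean V₁ V₂ U y k + g k) ^ 2)
        ∂Measure.pi (fun _ => gaussianReal 0 (σ ^ 2).toNNReal) =
        ENNReal.ofReal (specularMean V₁ V₂ U y k ^ 2 + σ ^ 2) := by
      intro k
      have hsq := lintegral_sq_gaussianReal (σ ^ 2).toNNReal (specularMean V₁ V₂ U y k)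
      rw [hv] at hsq
      rw [← hsq, ← (measurePreserving_eval
        (fun _ : Fin (n + 1) ⊕ Fin (n + 1) => gaussianReal 0 (σ ^ 2).toNNReal) k).lintegral_comp
        (f := fun x => ENNReal.ofReal ((specularMean V₁ V₂ U y k + x) ^ 2)) (by fun_prop)]
    simp only [hk]
    rw [← ENNReal.ofReal_sum_of_nonneg fun k _ => by positivity, Finset.sum_add_distrib,
      sum_specularMean_sq, Finset.sum_const, Finset.card_univ, Fintype.card_sum, Fintype.card_fin]
    congr 2
    simp
    ring
  simp only [hin]
  refine (h.lintegral_shadow_cos (H := fun p => ENNReal.ofReal (√p.1 ^ 2 *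
    (V₁ ^ 2 + V₂ ^ 2 + ∑ i, U i ^ 2 + 2 * V₁ * V₂ * p.2) + 2 * σ ^ 2 * (n + 1)))
    (by fun_prop)).trans ?_
  have hpr := isProbabilityMeasure_gammaMeasure hm hm
  have hz : ∀ θ, ∫⁻ z, ENNReal.ofReal (√z ^ 2 *
      (V₁ ^ 2 + V₂ ^ 2 + ∑ i, U i ^ 2 + 2 * V₁ * V₂ * Real.cos θ) + 2 * σ ^ 2 * (n + 1))
      ∂gammaMeasure m m = ENNReal.ofReal
      (V₁ ^ 2 + V₂ ^ 2 + ∑ i, U i ^ 2 + 2 * V₁ * V₂ * Real.cos θ + 2 * σ ^ 2 * (n + 1)) := by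
    intro θ
    have hpt : ∀ z : ℝ, ENNReal.ofReal (√z ^ 2 *
        (V₁ ^ 2 + V₂ ^ 2 + ∑ i, U i ^ 2 + 2 * V₁ * V₂ * Real.cos θ) + 2 * σ ^ 2 * (n + 1)) =
        ENNReal.ofReal z * ENNReal.ofReal (V₁ ^ 2 + V₂ ^ 2 + ∑ i, U i ^ 2 +
          2 * V₁ * V₂ * Real.cos θ) + ENNReal.ofReal (2 * σ ^ 2 * (n + 1)) := by
      intro z
      rw [ENNReal.ofReal_add (mul_nonneg (sq_nonneg _) (hc θ)) (by positivity),
        ENNReal.ofReal_mul (sq_nonneg _)]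
      congr 2
      rcases le_total 0 z with hz | hz
      · rw [Real.sq_sqrt hz]
      · rw [Real.sqrt_eq_zero_of_nonpos hz, ENNReal.ofReal_of_nonpos hz]; simp
    simp only [hpt]
    rw [lintegral_add_right _ measurable_const, lintegral_mul_const _ (by fun_prop),
      lintegral_id_gammaMeasure hm, lintegral_const, measure_univ, one_mul, mul_one,
      ← ENNReal.ofReal_add (hc θ) (by positivity)]
  simp only [hz]
  rw [lintegral_uniformPhase (by fun_prop) fun θ => add_nonneg (hc θ) (by positivity)]
  congr 1
  have hcalc : ∫ θ in 0..2 * Real.pi, (V₁ ^ 2 + V₂ ^ 2 + ∑ i, U i ^ 2 +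
      2 * V₁ * V₂ * Real.cos θ + 2 * σ ^ 2 * (n + 1)) =
      2 * Real.pi * (V₁ ^ 2 + V₂ ^ 2 + ∑ i, U i ^ 2 + 2 * σ ^ 2 * (n + 1)) := by
    have hre : ∀ θ, V₁ ^ 2 + V₂ ^ 2 + ∑ i, U i ^ 2 +
      2 * V₁ * V₂ * Real.cos θ + 2 * σ ^ 2 * (n + 1) =
      (V₁ ^ 2 + V₂ ^ 2 + ∑ i, U i ^ 2 + 2 * σ ^ 2 * (n + 1)) + 2 * V₁ * V₂ * Real.cos θ :=
      fun θ => by ring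
    simp only [hre]
    rw [intervalIntegral.integral_add intervalIntegrable_const
      ((Real.continuous_cos.const_mul _).intervalIntegrable _ _)]
    simp
    ring
  rw [hcalc, ← mul_assoc, inv_mul_cancel₀ (by positivity), one_mul]

end Model

theorem mftrPower_nonneg {Ω : Type*} {n : ℕ} (V₁ V₂ : ℝ) (U : Fin n → ℝ)
    (ξ : MFTRSource n → Ω → ℝ) (ω : Ω) : 0 ≤ mftrPower V₁ V₂ U ξ ω := by
  unfold mftrPower
  positivity

theorem mftrDelta_nonneg {n : ℕ} {V₁ V₂ : ℝ} (hV₁ : 0 ≤ V₁) (hV₂ : 0 ≤ V₂) (U : Fin n → ℝ) :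
    0 ≤ mftrDelta V₁ V₂ U := by
  unfold mftrDelta
  positivity

theorem mftrDelta_le_one {n : ℕ} (V₁ V₂ : ℝ) (U : Fin n → ℝ) : mftrDelta V₁ V₂ U ≤ 1 := by
  have hU : 0 ≤ ∑ i, U i ^ 2 := by positivity
  refine div_le_one_of_le₀ ?_ (by positivity)
  nlinarith [sq_nonneg (V₁ - V₂)]

/-- The product form also holds without specular power, so the degenerate case needs no separate
treatment later. -/
theorem mul_mftrDelta {n : ℕ} (V₁ V₂ : ℝ) (U : Fin n → ℝ) :
    (V₁ ^ 2 + V₂ ^ 2 + ∑ i, U i ^ 2) * mftrDelta V₁ V₂ U = 2 * V₁ * V₂ := by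
  have hU : 0 ≤ ∑ i, U i ^ 2 := by positivity
  rw [mftrDelta]
  by_cases h : V₁ ^ 2 + V₂ ^ 2 + ∑ i, U i ^ 2 = 0
  · have hV : V₁ = 0 := by
      have : V₁ ^ 2 = 0 := by nlinarith [sq_nonneg V₁, sq_nonneg V₂]
      exact pow_eq_zero_iff two_ne_zero |>.1 this
    rw [h, hV]
    simp
  · field_simp

/-! ### Matching the physical constants with K, Δ and the mean SNR -/

section Physical

variable {Ω : Type*} [MeasurableSpace Ω] {P : Measure Ω} {n m : ℕ} {σ : ℝ}
  {ξ : MFTRSource n → Ω → ℝ}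

theorem aemeasurable_mftrPower {M : ℝ} (h : IsMFTRModel P n M σ ξ) (V₁ V₂ : ℝ) (U : Fin n → ℝ) :
    AEMeasurable (mftrPower V₁ V₂ U ξ) P := by
  have heq : mftrPower V₁ V₂ U ξ = fun ω =>
      ∑ k, (specularMean V₁ V₂ U (fun b => ξ (specular b) ω) k + ξ (gauss k) ω) ^ 2 :=
    funext fun ω => mftrPower_eq_sum V₁ V₂ U ξ ω
  rw [heq]
  refine Finset.aemeasurable_fun_sum _ fun k _ => ?_
  refine AEMeasurable.pow_const (AEMeasurable.add ?_ (h.aemeasurable _)) 2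
  exact (measurable_specularMean V₁ V₂ U k).comp_aemeasurable
    (aemeasurable_pi_lambda _ fun b => h.aemeasurable _)

theorem integral_snr [IsProbabilityMeasure P] (hm : 0 < m) {V₁ V₂ c : ℝ} {U : Fin n → ℝ}
    (h : IsMFTRModel P n m σ ξ) :
    ∫ ω, c * mftrPower V₁ V₂ U ξ ω ∂P =
      c * (V₁ ^ 2 + V₂ ^ 2 + ∑ i, U i ^ 2 + 2 * σ ^ 2 * (n + 1)) := by
  rw [integral_const_mul, integral_eq_lintegral_of_nonneg_ae
    (Filter.Eventually.of_forall fun ω => mftrPower_nonneg V₁ V₂ U ξ ω)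
    (aemeasurable_mftrPower h V₁ V₂ U).aestronglyMeasurable,
    h.lintegral_mftrPower (Nat.cast_pos.2 hm), ENNReal.toReal_ofReal (by positivity)]

theorem hasPDFAndCDF_physical [IsProbabilityMeasure P] (hm : 0 < m) {V₁ V₂ c : ℝ} {U : Fin n → ℝ}
    (hV₁ : 0 ≤ V₁) (hV₂ : 0 ≤ V₂) (hσ : 0 < σ) (hc : 0 < c) (h : IsMFTRModel P n m σ ξ) :
    HasPDFAndCDF (P.map fun ω => c * mftrPower V₁ V₂ U ξ ω)
      (mftrPDF m ((n : ℝ) + 1) (mftrK V₁ V₂ U σ) (mftrDelta V₁ V₂ U)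
        (∫ ω, c * mftrPower V₁ V₂ U ξ ω ∂P))
      (mftrCDF m ((n : ℝ) + 1) (mftrK V₁ V₂ U σ) (mftrDelta V₁ V₂ U)
        (∫ ω, c * mftrPower V₁ V₂ U ξ ω ∂P)) := by
  rw [integral_snr hm h]
  have hmeas : AEMeasurable (fun ω => c * mftrPower V₁ V₂ U ξ ω) P :=
    (aemeasurable_mftrPower h V₁ V₂ U).const_mul c
  have hSΔ := mul_mftrDelta V₁ V₂ U
  have hK : mftrK V₁ V₂ U σ =
    (V₁ ^ 2 + V₂ ^ 2 + ∑ i, U i ^ 2) / (2 * σ ^ 2 * ((n : ℝ) + 1)) := rfl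
  have hS0 : 0 ≤ V₁ ^ 2 + V₂ ^ 2 + ∑ i, U i ^ 2 := by positivity
  have hΔ₀ := mftrDelta_nonneg hV₁ hV₂ U
  have hΔ₁ := mftrDelta_le_one V₁ V₂ U
  have hlap := fun s (hs : (0 : ℝ) ≤ s) =>
    h.lintegral_exp_neg_mftrPower hσ V₁ V₂ U (t := s * c) (by positivity)
  rw [hK]
  generalize mftrDelta V₁ V₂ U = Δ at *
  generalize V₁ ^ 2 + V₂ ^ 2 + ∑ i, U i ^ 2 = S at *
  have hn : (0 : ℝ) < n + 1 := by positivity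
  refine hasPDFAndCDF_of_lintegral_laplace hm hn (by positivity) hΔ₀ hΔ₁ (by positivity) ?_
    fun s hs => ?_
  · rw [Measure.map_apply_of_aemeasurable hmeas measurableSet_Iio]
    refine measure_mono_null (t := ∅) (fun ω hω => ?_) measure_empty
    exact absurd hω (not_lt.2 (mul_nonneg hc.le (mftrPower_nonneg V₁ V₂ U ξ ω)))
  -- With the mean SNR inserted, the rate r is the reciprocal of the diffuse scale 2cσ², so
  -- (r/(r+s))^μ is the Gaussian prefactor.
  · have hr : (1 + S / (2 * σ ^ 2 * ((n : ℝ) + 1))) * (n + 1) / (c * (S + 2 * σ ^ 2 * (n + 1))) =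
        1 / (2 * c * σ ^ 2) := by
      field_simp
      ring
    have hw : 0 < 1 + 2 * σ ^ 2 * (s * c) := by positivity
    have hq : 1 / (2 * c * σ ^ 2) / (1 / (2 * c * σ ^ 2) + s) = (1 + 2 * σ ^ 2 * (s * c))⁻¹ := by
      field_simp
    rw [hr, lintegral_map' (by fun_prop) hmeas, hq, ← Nat.cast_add_one, Real.rpow_natCast, inv_pow,
      Nat.cast_add_one]
    have hexp : ∀ ω, ENNReal.ofReal (Real.exp (-(s * (c * mftrPower V₁ V₂ U ξ ω)))) =
        ENNReal.ofReal (Real.exp (-(s * c * mftrPower V₁ V₂ U ξ ω))) := fun ω => by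
      rw [mul_assoc]
    simp only [hexp]
    rw [hlap s hs]
    congr 1
    refine lintegral_congr fun θ => lintegral_congr_ae ?_
    have hz : ∀ᵐ z ∂gammaMeasure (m : ℝ) m, 0 ≤ z := by
      rw [ae_iff]
      simp only [not_le]
      exact gammaMeasure_Iio_zero (m : ℝ) m
    filter_upwards [hz] with z hz
    -- Writing the cross term 2V₁V₂ as SΔ exhibits the specular power as S(1+Δ cos θ), where S =
    -- 2σ²μK.
    rw [Real.sq_sqrt hz, ← hSΔ]
    congr 3
    have hq' : s / (1 / (2 * c * σ ^ 2) + s) =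
        2 * c * σ ^ 2 * s / (1 + 2 * σ ^ 2 * (s * c)) := by
      field_simp
    rw [hq']
    field_simp

end Physical

theorem lemma2 (m : ℕ) (hm : 0 < m) :
    -- the physical model, with the integer number `μ = n + 1` of clusters
    (∀ {Ω : Type*} [MeasurableSpace Ω] (P : Measure Ω) [IsProbabilityMeasure P]
      (n : ℕ) (V₁ V₂ σ Es N₀ : ℝ) (U : Fin n → ℝ) (ξ : MFTRSource n → Ω → ℝ) (γ : Ω → ℝ),
      0 ≤ V₁ → 0 ≤ V₂ → (∀ i, 0 ≤ U i) → 0 < σ → 0 < Es → 0 < N₀ →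
      IsMFTRModel P n m σ ξ →
      (∀ ω, γ ω = Es / N₀ * mftrPower V₁ V₂ U ξ ω) →
      HasPDFAndCDF (P.map γ)
        (mftrPDF m ((n : ℝ) + 1) (mftrK V₁ V₂ U σ) (mftrDelta V₁ V₂ U) (∫ ω, γ ω ∂P))
        (mftrCDF m ((n : ℝ) + 1) (mftrK V₁ V₂ U σ) (mftrDelta V₁ V₂ U) (∫ ω, γ ω ∂P))) ∧
    -- the generalized model, with a real parameter `μ > 0`
    (∀ μ K Δ γbar : ℝ, 0 < μ → 0 ≤ K → 0 ≤ Δ → Δ ≤ 1 → 0 < γbar →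
      HasPDFAndCDF (mftrLaw m μ K Δ γbar)
        (mftrPDF m μ K Δ γbar) (mftrCDF m μ K Δ γbar)) := by
  refine ⟨?_, fun μ K Δ γbar hμ hK hΔ hΔ' hγ => hasPDFAndCDF_mftrLaw hm hμ hK hΔ hΔ' hγ⟩
  intro Ω _ P _ n V₁ V₂ σ Es N₀ U ξ γ hV₁ hV₂ _ hσ hEs hN₀ h hγ
  obtain rfl : γ = fun ω => Es / N₀ * mftrPower V₁ V₂ U ξ ω := funext hγ
  exact hasPDFAndCDF_physical hm hV₁ hV₂ hσ (div_pos hEs hN₀) h
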